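/- A rooted tree is a finite tree with a distinguished vertex, the root. A leaf of a rooted tree is a vertex of valence one other than the root, except that the root of the one-vertex tree is considered as a leaf. Rooted unlabelled trees are rooted trees up to isomorphism (of graphs, preserving the root). Let $a_{n,k}$ be the number of rooted unlabelled trees with $n$ vertices and $k$ leaves, and let $D\subset\mathbb{C}^2$ be the domain of convergence of the power series $T(x,z)=\sum_{n,k}a_{n,k}x^nz^k$, i.e. the interior of the set of points at which it converges (absolutely). For $\zeta>0$ let $r(\zeta)=\sup\{|x| : (x,\zeta)\in D\}$, let $x_0=\sup_{\zeta>0} r(\zeta)\sqrt{\zeta}$, and let $C_1=1/x_0$. For an integer $d\ge 1$ let $N_d=\frac{(d-1)(d-2)}2+1$ if $d$ is odd and $N_d=\frac{(d-1)(d-2)}2+2$ if $d$ is even, and let $K_d=N_d-1-\left[\frac{d-1}2\right]\left(\left[\frac{d-1}2\right]-1\right)$, where $[\cdot]$ is the integer part. Let $L_d$ be the number of rooted unlabelled trees with exactly $N_d$ vertices and at least $K_d$ leaves. **Proposition 8.** $L_d$ is exponentially equivalent to $C_1^{d^2/2}$, that is, $$\log L_d\sim \frac{d^2}{2}\log C_1\qquad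 (d\to\infty).$$ -/

import Mathlib

open Filter Asymptotics

namespace TreeLeaves

/-- A rooted tree on the vertex set `Fin n`: a tree (as a graph) with a distinguished vertex. -/
structure LabelledTree (n : ℕ) where
  graph : SimpleGraph (Fin n)
  isTree : graph.IsTree
  root : Fin n

namespace LabelledTree

variable {n : ℕ}

/-- A vertex is a leaf if it has valence one and is not the root; the root is a leaf exactly when
the tree has no other vertices. -/
def IsLeaf (t : LabelledTree n) (v : Fin n) : Prop :=
  (v ≠ t.root ∧ (t.graph.neighborSet v).ncard = 1) ∨ (v = t.root ∧ n = 1)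

/-- The number of leaves. -/
noncomputable def numLeaves (t : LabelledTree n) : ℕ := {v : Fin n | t.IsLeaf v}.ncard

/-- Isomorphism of rooted trees: a graph isomorphism that sends the root to the root. -/
def Iso (s t : LabelledTree n) : Prop := ∃ e : s.graph ≃g t.graph, e s.root = t.root

theorem Iso.refl (t : LabelledTree n) : Iso t t := ⟨RelIso.refl _, rfl⟩

theorem Iso.symm {s t : LabelledTree n} (h : Iso s t) : Iso t s := by
  obtain ⟨e, he⟩ := h
  exact ⟨e.symm, by rw [← he]; exact e.symm_apply_apply _⟩

theorem Iso.trans {s t u : LabelledTree n} (h : Iso s t) (h' : Iso t u) : Iso s u := by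
  obtain ⟨e, he⟩ := h
  obtain ⟨f, hf⟩ := h'
  exact ⟨e.trans f, by rw [← hf, ← he]; rfl⟩

instance setoid (n : ℕ) : Setoid (LabelledTree n) where
  r := Iso
  iseqv := ⟨Iso.refl, Iso.symm, Iso.trans⟩

theorem numLeaves_eq_of_iso {s t : LabelledTree n} (h : Iso s t) :
    s.numLeaves = t.numLeaves := by
  obtain ⟨e, he⟩ := h
  have key : ∀ v, t.IsLeaf (e v) ↔ s.IsLeaf v := by
    intro v
    have h1 : t.graph.neighborSet (e v) = e '' s.graph.neighborSet v := by
      ext w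
      obtain ⟨w, rfl⟩ := e.surjective w
      simpa using e.map_adj_iff
    have h2 : e v = t.root ↔ v = s.root := by
      rw [← he]
      exact e.injective.eq_iff
    unfold IsLeaf
    rw [h1, Set.ncard_image_of_injective _ e.injective, Ne, h2]
  have himg : {v | t.IsLeaf v} = e '' {v | s.IsLeaf v} := by
    ext w
    obtain ⟨w, rfl⟩ := e.surjective w
    simp [key]
  unfold numLeaves
  rw [himg, Set.ncard_image_of_injective _ e.injective]

end LabelledTree

/-- Rooted unlabelled trees with `n` vertices: isomorphism classes of rooted trees. -/
def UnlabelledTree (n : ℕ) : Type := Quotient (LabelledTree.setoid n)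

/-- The number of leaves of a rooted unlabelled tree. -/
noncomputable def UnlabelledTree.numLeaves {n : ℕ} (c : UnlabelledTree n) : ℕ :=
  Quotient.lift LabelledTree.numLeaves (fun _ _ h => LabelledTree.numLeaves_eq_of_iso h) c

/-- The number `a_{n,k}` of rooted unlabelled trees with `n` vertices and `k` leaves. -/
noncomputable def a (n k : ℕ) : ℕ := Nat.card {c : UnlabelledTree n // c.numLeaves = k}

/-- The domain of convergence of `T(x,z) = ∑ a_{n,k} x^n z^k`: the interior of the set of points
of `ℂ²` at which the double series converges (absolutely). -/
def convergenceDomain : Set (ℂ × ℂ) :=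
  interior {p | Summable fun q : ℕ × ℕ => (a q.1 q.2 : ℂ) * p.1 ^ q.1 * p.2 ^ q.2}

/-- The function `r` on `ζ > 0` describing the domain of convergence as `|x| < r(|z|)`. -/
noncomputable def r (ζ : ℝ) : ℝ :=
  sSup {ρ : ℝ | ∃ x : ℂ, (x, (ζ : ℂ)) ∈ convergenceDomain ∧ ρ = ‖x‖}

/-- The maximum `x₀` of `r(ζ) √ζ` over `ζ > 0`. -/
noncomputable def x₀ : ℝ := sSup {y : ℝ | ∃ ζ : ℝ, 0 < ζ ∧ y = r ζ * Real.sqrt ζ}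

/-- The constant `C₁ = 1 / x₀`. -/
noncomputable def C₁ : ℝ := 1 / x₀

/-- Exponential equivalence of sequences: `log a_m ∼ log b_m` as `m → ∞`. -/
def ExpEquivalent (u v : ℕ → ℝ) : Prop :=
  (fun m => Real.log (u m)) ~[atTop] (fun m => Real.log (v m))

/-- `N_d = (d-1)(d-2)/2 + 1` for odd `d` and `(d-1)(d-2)/2 + 2` for even `d` (`d ≥ 1`). -/
def N (d : ℕ) : ℕ := if Odd d then (d - 1) * (d - 2) / 2 + 1 else (d - 1) * (d - 2) / 2 + 2

/-- `K_d = N_d - 1 - [(d-1)/2]([(d-1)/2] - 1)`, as an integer (`d ≥ 1`). -/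
def K (d : ℕ) : ℤ := (N d : ℤ) - 1 - (((d - 1) / 2 : ℕ) : ℤ) * ((((d - 1) / 2 : ℕ) : ℤ) - 1)

/-- The number of rooted unlabelled trees with exactly `N_d` vertices and at least `K_d` leaves. -/
noncomputable def L (d : ℕ) : ℕ :=
  Nat.card {c : UnlabelledTree (N d) // K d ≤ (c.numLeaves : ℤ)}

end TreeLeaves

/-!
Write `n` for the number of vertices of a tree, `k` for its number of leaves, `D` for the domain of
convergence, and put `y = |x| √ζ` at a point `(x, ζ)` of `D`. The weight `|x| ^ n ζ ^ k` of a tree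
is `y ^ n ζ ^ (k - n / 2)`, so that `x₀`, the supremum of the numbers `y`, governs the trees with
`k ≈ n / 2`. As `2 K d - N d` is nonnegative and of order `d` only, the claim is that the trees with
`n` vertices and at least `n / 2` leaves have the growth rate `1 / x₀`.

*Upper bound* (`exists_card_mul_pow_le`). If `ζ ≥ 1`, a tree with `k ≥ n / 2` has weight at least
`y ^ n`, while the sum of the weights of all trees with `n` vertices is `O(n)`. If `ζ ≤ 1`, even the
number of all trees with `n` vertices is `O(n y ^ (-n))`: since `e ^ t ≥ 1 + t`, this follows from
the fact that for every `n ≥ 2` the mean number of leaves of a tree with `n` vertices is at most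
`n / 2` (`sum_excess_nonpos`). To prove the latter, let `S n` be the sum of `2 k - n` over the trees
with `n` vertices and `t n` the number of these trees. Counting the trees that have at least `j`
copies of a given tree at the root gives
`S n = -t n + ∑ S m * t (n - j m)` over `m, j ≥ 1`, and induction leaves the terms with `m = 1`,
whose sum is at most `t n` because `t (n + 1) ≥ 2 t n` for `n ≥ 2`.

*Lower bound* (`pow_le_card_filter`). For `μ < 1 / x₀` and every `ζ`, the point with `y = 1 / μ`
lies outside `D`, so that some large class of trees, those with given `n` and `k`, has at least
`μ ^ n ζ ^ (n / 2 - k)` elements. The classes are essentially supermultiplicative (`a_mul_a_le`). At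
the value of `ζ` where these classes pass from `k < n / 2` to `k ≥ n / 2`, suitable multiples of two
of them combine to a class with `k ≥ n / 2` and at least about `μ ^ n` elements (`exists_block`).
Powers of this class, filled up with leaves at the root, give the bound.

Comparing logarithms also needs `0 < x₀ < 1`, which comes from `t n ≤ 4 ^ n` and
`t (n + 2) ≥ 2 ^ n`.

For the combinatorics the isomorphism classes of graphs are replaced by a type `UTree` in which a
tree is the same as a multiset of trees (`UTree.nodeEquiv`).
-/

namespace TreeLeaves

/-! ### Rooted trees as parent maps -/

open Classical in
/-- Matching of two finite families with the same multiset of labels. -/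
theorem exists_injOn_of_map_eq {α β γ : Type*} [Nonempty β] (f : α → γ) (g : β → γ)
    (s : Finset α) (t : Finset β) (h : s.val.map f = t.val.map g) :
    ∃ σ : α → β, (∀ x ∈ s, σ x ∈ t ∧ g (σ x) = f x) ∧ Set.InjOn σ s := by
  induction s using Finset.induction_on generalizing t with
  | empty => exact ⟨fun _ => Classical.arbitrary β, by simp, by simp⟩
  | insert x s hx ih =>
    rw [Finset.insert_val_of_notMem hx, Multiset.map_cons] at h
    have hm : f x ∈ t.val.map g := by rw [← h]; exact Multiset.mem_cons_self _ _
    obtain ⟨y, hy, hyx⟩ := Multiset.mem_map.1 hm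
    have hy' : y ∈ t := hy
    have h2 : s.val.map f = (t.erase y).val.map g := by
      have h3 : t.val = y ::ₘ (t.erase y).val := by
        rw [Finset.erase_val, Multiset.cons_erase hy]
      rw [h3, Multiset.map_cons, hyx] at h
      exact (Multiset.cons_inj_right _).1 h
    obtain ⟨σ, h4, h5⟩ := ih _ h2
    have hne : ∀ z ∈ s, z ≠ x := fun z hz e => hx (e ▸ hz)
    refine ⟨Function.update σ x y, ?_, ?_⟩
    · intro z hz
      rcases Finset.mem_insert.1 hz with rfl | hz
      · simp [hy', hyx]
      · rw [Function.update_of_ne (hne z hz)]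
        exact ⟨Finset.mem_of_mem_erase (h4 z hz).1, (h4 z hz).2⟩
    · have hy2 : ∀ z ∈ s, σ z ≠ y := fun z hz => Finset.ne_of_mem_erase (h4 z hz).1
      intro z hz w hw hzw
      rw [Finset.mem_coe, Finset.mem_insert] at hz hw
      rcases hz with rfl | hz <;> rcases hw with rfl | hw
      · rfl
      · rw [Function.update_self, Function.update_of_ne (hne w hw)] at hzw
        exact absurd hzw.symm (hy2 w hw)
      · rw [Function.update_self, Function.update_of_ne (hne z hz)] at hzw
        exact absurd hzw (hy2 z hz)
      · rw [Function.update_of_ne (hne z hz), Function.update_of_ne (hne w hw)] at hzw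
        exact h5 hz hw hzw

/-- A rooted tree on the vertex set `V`, given by the map that sends a vertex to its parent. The
root is its own parent, and a rank that drops along parents (not necessarily the depth)
keeps the map from having other cycles. -/
structure ParentTree (V : Type) where
  root : V
  par : V → V
  rank : V → ℕ
  par_root : par root = root
  rank_par : ∀ v, v ≠ root → rank (par v) < rank v

namespace ParentTree

variable {V W : Type}

/-- Induction from the root to the leaves. -/
theorem par_induction (t : ParentTree V) {P : V → Prop} (h0 : P t.root)
    (h : ∀ v, v ≠ t.root → P (t.par v) → P v) (v : V) : P v := by
  induction hn : t.rank v using Nat.strong_induction_on generalizing v with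
  | _ n ih =>
    by_cases hv : v = t.root
    · rw [hv]; exact h0
    · exact h v hv (ih _ (hn ▸ t.rank_par v hv) _ rfl)

/-- An isomorphism of rooted trees is a bijection that respects the root and the parent map. -/
structure IsIso (s : ParentTree V) (t : ParentTree W) (e : V ≃ W) : Prop where
  root : e s.root = t.root
  par : ∀ v, e (s.par v) = t.par (e v)

/-- Relabelling of the vertices. -/
def relabel (t : ParentTree V) (e : V ≃ W) : ParentTree W where
  root := e t.root
  par w := e (t.par (e.symm w))
  rank w := t.rank (e.symm w)
  par_root := by simp [t.par_root]
  rank_par w hw := by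
    simpa using t.rank_par (e.symm w) fun h => hw (by rw [← h, Equiv.apply_symm_apply])

theorem isIso_relabel (t : ParentTree V) (e : V ≃ W) : IsIso t (t.relabel e) e :=
  ⟨rfl, fun v => by simp [relabel]⟩

open Classical in
/-- The map that sends the root of `s` to the root of `t` and, recursively, a child of a vertex
`x` to the child of the image `y` of `x` which a given matching `σ x y` of children prescribes. -/
noncomputable def transport (s : ParentTree V) (t : ParentTree W) (σ : V → W → V → W) (v : V) : W :=
  if _h : v = s.root then t.root else σ (s.par v) (transport s t σ (s.par v)) v
termination_by s.rank v
decreasing_by exact s.rank_par v _h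

theorem transport_root (s : ParentTree V) (t : ParentTree W) (σ : V → W → V → W) :
    transport s t σ s.root = t.root := by
  rw [transport, dif_pos rfl]

theorem transport_of_ne (s : ParentTree V) (t : ParentTree W) (σ : V → W → V → W) {v : V}
    (h : v ≠ s.root) :
    transport s t σ v = σ (s.par v) (transport s t σ (s.par v)) v := by
  rw [transport, dif_neg h]

variable [Fintype V] [Fintype W]

open Classical in
/-- The children of a vertex. -/
noncomputable def children (t : ParentTree V) (v : V) : Finset V :=
  Finset.univ.filter fun c => c ≠ t.root ∧ t.par c = v

theorem mem_children {t : ParentTree V} {v c : V} :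
    c ∈ t.children v ↔ c ≠ t.root ∧ t.par c = v := by
  simp [children]

theorem rank_lt_of_mem_children {t : ParentTree V} {v c : V} (h : c ∈ t.children v) :
    t.rank v < t.rank c := by
  obtain ⟨h1, rfl⟩ := mem_children.1 h
  exact t.rank_par c h1

/-- Induction from the leaves to the root. -/
theorem children_induction (t : ParentTree V) {P : V → Prop}
    (h : ∀ v, (∀ c ∈ t.children v, P c) → P v) (v : V) : P v := by
  induction hn : Finset.univ.sup t.rank - t.rank v using Nat.strong_induction_on generalizing v with
  | _ n ih =>
    refine h v fun c hc => ih _ ?_ c rfl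
    have h1 := rank_lt_of_mem_children hc
    have h2 : t.rank c ≤ Finset.univ.sup t.rank := Finset.le_sup (Finset.mem_univ c)
    omega

/-- The code of a vertex: a natural number that encodes the multiset of the codes of its
children. It determines the subtree that hangs from the vertex up to isomorphism. -/
noncomputable def code (t : ParentTree V) (v : V) : ℕ :=
  Encodable.encode ((t.children v).attach.val.map fun c => t.code c.1)
termination_by Finset.univ.sup t.rank - t.rank v
decreasing_by
  have h1 := rank_lt_of_mem_children c.2
  have h2 : t.rank c.1 ≤ Finset.univ.sup t.rank := Finset.le_sup (Finset.mem_univ c.1)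
  omega

theorem code_eq (t : ParentTree V) (v : V) :
    t.code v = Encodable.encode ((t.children v).val.map t.code) := by
  rw [code]
  congr 1
  exact Multiset.attach_map_val' _ _

theorem code_unique (t : ParentTree V) (f : V → ℕ)
    (hf : ∀ v, f v = Encodable.encode ((t.children v).val.map f)) (v : V) : f v = t.code v := by
  induction v using t.children_induction with
  | h v ih =>
    rw [hf, code_eq]
    congr 1
    exact Multiset.map_congr rfl ih

/-- The number of vertices without children. -/
noncomputable def numLeaves (t : ParentTree V) : ℕ := {v | t.children v = ∅}.ncard

/-! ### Isomorphisms -/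

theorem IsIso.children {s : ParentTree V} {t : ParentTree W} {e : V ≃ W} (h : IsIso s t e) (v : V) :
    t.children (e v) = (s.children v).map e.toEmbedding := by
  ext w
  obtain ⟨w, rfl⟩ := e.surjective w
  simp only [mem_children, Finset.mem_map_equiv, Equiv.symm_apply_apply, ← h.par, ← h.root, ne_eq,
    e.injective.eq_iff]

theorem IsIso.code {s : ParentTree V} {t : ParentTree W} {e : V ≃ W} (h : IsIso s t e) (v : V) :
    t.code (e v) = s.code v := by
  refine code_unique s (fun v => t.code (e v)) (fun v => ?_) v
  simp only [t.code_eq (e v), h.children, Finset.map_val, Multiset.map_map]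
  rfl

theorem IsIso.numLeaves {s : ParentTree V} {t : ParentTree W} {e : V ≃ W} (h : IsIso s t e) :
    t.numLeaves = s.numLeaves := by
  have : {v | t.children v = ∅} = e '' {v | s.children v = ∅} := by
    ext w
    obtain ⟨w, rfl⟩ := e.surjective w
    simp [h.children]
  unfold ParentTree.numLeaves
  rw [this, Set.ncard_image_of_injective _ e.injective]

/-- Trees whose roots have the same code embed into each other: a map is built from the root
downwards, by matching children with the same codes. -/
theorem exists_injective_of_code_eq (s : ParentTree V) (t : ParentTree W)
    (h : s.code s.root = t.code t.root) :
    ∃ φ : V → W, Function.Injective φ ∧ φ s.root = t.root ∧ ∀ v, φ (s.par v) = t.par (φ v) := by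
  have : Nonempty W := ⟨t.root⟩
  have key : ∀ x y, ∃ σ : V → W, s.code x = t.code y →
      (∀ c ∈ s.children x, σ c ∈ t.children y ∧ t.code (σ c) = s.code c) ∧
        Set.InjOn σ (s.children x) := by
    intro x y
    by_cases hxy : s.code x = t.code y
    · have h1 := hxy
      rw [code_eq, code_eq] at h1
      obtain ⟨σ, h2⟩ := exists_injOn_of_map_eq _ _ _ _ (Encodable.encode_injective h1)
      exact ⟨σ, fun _ => h2⟩
    · exact ⟨fun _ => t.root, fun h => absurd h hxy⟩
  choose σ hσ using key
  set φ := transport s t σ with hφ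
  have hroot : φ s.root = t.root := transport_root s t σ
  have hmem : ∀ v, v ≠ s.root → v ∈ s.children (s.par v) := fun v hv => mem_children.2 ⟨hv, rfl⟩
  have hcode : ∀ v, s.code v = t.code (φ v) := by
    intro v
    induction v using s.par_induction with
    | h0 => rw [hroot, h]
    | h v hv ih =>
      rw [hφ, transport_of_ne s t σ hv]
      exact ((hσ _ _ ih).1 v (hmem v hv)).2.symm
  have hchild : ∀ v, v ≠ s.root → φ v ∈ t.children (φ (s.par v)) := by
    intro v hv
    rw [hφ, transport_of_ne s t σ hv]
    exact ((hσ _ _ (hcode _)).1 v (hmem v hv)).1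
  have hpar : ∀ v, φ (s.par v) = t.par (φ v) := by
    intro v
    by_cases hv : v = s.root
    · rw [hv, s.par_root, hroot, t.par_root]
    · exact (mem_children.1 (hchild v hv)).2.symm
  have hne : ∀ v, v ≠ s.root → φ v ≠ t.root := fun v hv => (mem_children.1 (hchild v hv)).1
  refine ⟨φ, ?_, hroot, hpar⟩
  intro v
  induction v using s.par_induction with
  | h0 =>
    intro w hw
    by_contra hne'
    exact hne w (Ne.symm hne') (by rw [← hw, hroot])
  | h v hv ih =>
    intro w hw
    have hw0 : w ≠ s.root := by
      rintro rfl
      exact hne v hv (by rw [hw, hroot])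
    have h1 : s.par v = s.par w := ih (by rw [hpar, hpar, hw])
    rw [hφ, transport_of_ne s t σ hv, transport_of_ne s t σ hw0, ← h1] at hw
    exact (hσ _ _ (hcode (s.par v))).2 (hmem v hv) (h1 ▸ hmem w hw0) hw

/-- Trees whose roots have the same code are isomorphic. -/
theorem exists_isIso_of_code_eq (s : ParentTree V) (t : ParentTree W)
    (h : s.code s.root = t.code t.root) : ∃ e : V ≃ W, IsIso s t e := by
  obtain ⟨φ, h1, h2, h3⟩ := exists_injective_of_code_eq s t h
  obtain ⟨ψ, h4, -⟩ := exists_injective_of_code_eq t s h.symm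
  have hcard : Fintype.card V = Fintype.card W :=
    le_antisymm (Fintype.card_le_of_injective φ h1) (Fintype.card_le_of_injective ψ h4)
  have hb : Function.Bijective φ := (Fintype.bijective_iff_injective_and_card φ).2 ⟨h1, hcard⟩
  exact ⟨Equiv.ofBijective φ hb, h2, h3⟩

/-! ### Grafting -/

/-- The one-vertex tree. -/
def single : ParentTree Unit where
  root := ()
  par := id
  rank _ := 0
  par_root := rfl
  rank_par _ hv := absurd rfl hv

/-- The tree obtained from `s` and `t` by making the root of `s` a child of the root of `t`. -/
noncomputable def graft (s : ParentTree V) (t : ParentTree W) : ParentTree (V ⊕ W) where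
  root := Sum.inr t.root
  par := Sum.elim
    (fun v => open Classical in if v = s.root then Sum.inr t.root else Sum.inl (s.par v))
    (fun w => Sum.inr (t.par w))
  rank := Sum.elim (fun v => s.rank v + t.rank t.root + 1) t.rank
  par_root := by simp [t.par_root]
  rank_par := by
    rintro (v | w) h
    · by_cases hv : v = s.root
      · simp [hv]
      · have := s.rank_par v hv
        simp [hv]; omega
    · have := t.rank_par w (fun h' => h (by rw [h']))
      simpa using this

theorem children_single : single.children () = ∅ := by
  ext c
  simp [mem_children, single]

theorem children_graft_inl (s : ParentTree V) (t : ParentTree W) (v : V) :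
    (s.graft t).children (Sum.inl v) = (s.children v).map Function.Embedding.inl := by
  ext (c | c)
  · by_cases hc : c = s.root <;> simp [mem_children, graft, hc]
  · simp [mem_children, graft]

theorem children_graft_inr (s : ParentTree V) (t : ParentTree W) {w : W} (hw : w ≠ t.root) :
    (s.graft t).children (Sum.inr w) = (t.children w).map Function.Embedding.inr := by
  ext (c | c)
  · by_cases hc : c = s.root <;> simp [mem_children, graft, hc, hw.symm]
  · simp [mem_children, graft]

open Classical in
theorem children_graft_root (s : ParentTree V) (t : ParentTree W) :
    (s.graft t).children (Sum.inr t.root) = Finset.cons (Sum.inl s.root)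
      ((t.children t.root).map Function.Embedding.inr) (by simp) := by
  ext (c | c)
  · by_cases hc : c = s.root <;> simp [mem_children, graft, hc]
  · simp [mem_children, graft]

theorem code_graft (s : ParentTree V) (t : ParentTree W) :
    (s.graft t).code (s.graft t).root =
      Encodable.encode (s.code s.root ::ₘ (t.children t.root).val.map t.code) := by
  have hinl : ∀ v, (s.graft t).code (Sum.inl v) = s.code v := by
    refine code_unique s (fun v => (s.graft t).code (Sum.inl v)) fun v => ?_
    rw [code_eq, children_graft_inl, Finset.map_val, Multiset.map_map]
    rfl
  have hinr : ∀ w, w ≠ t.root → (s.graft t).code (Sum.inr w) = t.code w := by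
    intro w
    induction w using t.children_induction with
    | h w ih =>
      intro hw
      rw [code_eq, children_graft_inr s t hw, Finset.map_val, Multiset.map_map, code_eq]
      congr 1
      exact Multiset.map_congr rfl fun c hc => ih c hc (mem_children.1 hc).1
  change (s.graft t).code (Sum.inr t.root) = _
  rw [code_eq, children_graft_root, Finset.cons_val, Multiset.map_cons, hinl, Finset.map_val,
    Multiset.map_map]
  congr 2
  exact Multiset.map_congr rfl fun c hc => hinr c (mem_children.1 hc).1

theorem children_root_eq_empty_iff (t : ParentTree V) :
    t.children t.root = ∅ ↔ Fintype.card V = 1 := by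
  constructor
  · intro h
    rw [Fintype.card_eq_one_iff]
    refine ⟨t.root, fun v => ?_⟩
    induction v using t.par_induction with
    | h0 => rfl
    | h v hv ih =>
      have : v ∈ t.children t.root := mem_children.2 ⟨hv, ih⟩
      rw [h] at this
      simp at this
  · intro h
    obtain ⟨x, hx⟩ := Fintype.card_eq_one_iff.1 h
    ext c
    simp [mem_children, hx c, hx t.root]

theorem numLeaves_single : single.numLeaves = 1 := by
  have : {v | single.children v = ∅} = {()} := by
    ext x
    simp only [Set.mem_ofPred_eq, Set.mem_singleton_iff, iff_true]
    exact children_single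
  rw [numLeaves, this, Set.ncard_singleton]

theorem numLeaves_graft (s : ParentTree V) (t : ParentTree W) :
    (s.graft t).numLeaves =
      if Fintype.card W = 1 then s.numLeaves else s.numLeaves + t.numLeaves := by
  have h : {x | (s.graft t).children x = ∅} = Sum.inl '' {v | s.children v = ∅} ∪
      Sum.inr '' {w | t.children w = ∅ ∧ w ≠ t.root} := by
    ext (v | w)
    · simp [children_graft_inl]
    · by_cases hw : w = t.root
      · subst hw
        simp [children_graft_root]
      · simp [children_graft_inr s t hw, hw]
  have h' : (s.graft t).numLeaves =
      s.numLeaves + {w | t.children w = ∅ ∧ w ≠ t.root}.ncard := by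
    rw [numLeaves, h, Set.ncard_union_eq, Set.ncard_image_of_injective _ Sum.inl_injective,
      Set.ncard_image_of_injective _ Sum.inr_injective]
    · rfl
    · rw [Set.disjoint_left]
      rintro _ ⟨v, -, rfl⟩ ⟨w, -, hw⟩
      cases hw
  rw [h']
  split_ifs with hc
  · have : {w | t.children w = ∅ ∧ w ≠ t.root} = ∅ := by
      obtain ⟨x, hx⟩ := Fintype.card_eq_one_iff.1 hc
      ext w
      simp [hx w, hx t.root]
    rw [this, Set.ncard_empty, add_zero]
  · congr 2
    ext w
    simp only [Set.mem_ofPred_eq, and_iff_left_iff_imp]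
    rintro h1 rfl
    exact hc ((children_root_eq_empty_iff t).1 h1)

end ParentTree

/-! ### Parent maps and graphs -/

namespace ParentTree

variable {V : Type}

/-- The underlying graph: a vertex is joined to its parent. -/
def toGraph (t : ParentTree V) : SimpleGraph V where
  Adj v w := v ≠ w ∧ (t.par v = w ∨ t.par w = v)
  symm := ⟨fun _ _ h => ⟨h.1.symm, h.2.symm⟩⟩
  loopless := ⟨fun _ h => h.1 rfl⟩

theorem par_ne (t : ParentTree V) {v : V} (hv : v ≠ t.root) : t.par v ≠ v := by
  intro h
  have := t.rank_par v hv
  rw [h] at this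
  exact lt_irrefl _ this

theorem toGraph_adj_par (t : ParentTree V) {v : V} (hv : v ≠ t.root) :
    t.toGraph.Adj v (t.par v) :=
  ⟨(t.par_ne hv).symm, Or.inl rfl⟩

theorem toGraph_connected (t : ParentTree V) : t.toGraph.Connected := by
  have h : ∀ v, t.toGraph.Reachable v t.root := by
    intro v
    induction v using t.par_induction with
    | h0 => exact SimpleGraph.Reachable.refl _
    | h v hv ih => exact (t.toGraph_adj_par hv).reachable.trans ih
  have : Nonempty V := ⟨t.root⟩
  exact ⟨fun v w => (h v).trans (h w).symm⟩

theorem toGraph_isTree [Fintype V] (t : ParentTree V) : t.toGraph.IsTree := by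
  classical
  rw [SimpleGraph.isTree_iff_connected_and_card]
  refine ⟨t.toGraph_connected, le_antisymm ?_ t.toGraph_connected.card_vert_le_card_edgeSet_add_one⟩
  -- Every edge joins a vertex other than the root to its parent.
  have hsurj : Function.Surjective (fun v : {v : V // v ≠ t.root} =>
      (⟨s(v.1, t.par v.1), t.toGraph_adj_par v.2⟩ : t.toGraph.edgeSet)) := by
    rintro ⟨e, he⟩
    induction e using Sym2.ind with
    | _ v w =>
      obtain ⟨hne, h | h⟩ := he
      · have hv : v ≠ t.root := by
          rintro rfl
          exact hne (by rw [← h, t.par_root])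
        exact ⟨⟨v, hv⟩, by simp [h]⟩
      · have hw : w ≠ t.root := by
          rintro rfl
          exact hne (by rw [← h, t.par_root])
        exact ⟨⟨w, hw⟩, by simp [h, Sym2.eq_swap]⟩
  have h1 : Nat.card t.toGraph.edgeSet ≤ Nat.card {v : V // v ≠ t.root} :=
    Nat.card_le_card_of_surjective _ hsurj
  have h2 : Nat.card {v : V // v ≠ t.root} + 1 = Nat.card V := by
    rw [Nat.card_eq_fintype_card, Nat.card_eq_fintype_card, Fintype.card_subtype_compl,
      Fintype.card_subtype_eq]
    have : 0 < Fintype.card V := Fintype.card_pos_iff.2 ⟨t.root⟩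
    omega
  omega

theorem neighborSet_toGraph [Fintype V] (t : ParentTree V) {v : V} (hv : v ≠ t.root) :
    t.toGraph.neighborSet v = insert (t.par v) (t.children v : Set V) := by
  ext w
  simp only [SimpleGraph.mem_neighborSet, Set.mem_insert_iff, Finset.mem_coe, mem_children]
  constructor
  · rintro ⟨hne, h | h⟩
    · exact Or.inl h.symm
    · refine Or.inr ⟨?_, h⟩
      rintro rfl
      exact hne (by rw [← h, t.par_root])
  · rintro (rfl | ⟨hw, rfl⟩)
    · exact t.toGraph_adj_par hv
    · exact (t.toGraph_adj_par hw).symm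

/-- The rooted tree, as a graph with a distinguished vertex. -/
def toLabelled {n : ℕ} (t : ParentTree (Fin n)) : LabelledTree n :=
  ⟨t.toGraph, t.toGraph_isTree, t.root⟩

theorem isLeaf_toLabelled {n : ℕ} (t : ParentTree (Fin n)) (v : Fin n) :
    t.toLabelled.IsLeaf v ↔ t.children v = ∅ := by
  by_cases hv : v = t.root
  · subst hv
    rw [children_root_eq_empty_iff, Fintype.card_fin]
    simp [LabelledTree.IsLeaf, toLabelled]
  · have hp : t.par v ∉ (t.children v : Set (Fin n)) := by
      intro h
      have h1 := rank_lt_of_mem_children h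
      have h2 := t.rank_par v hv
      omega
    have : t.toLabelled.graph.neighborSet v = insert (t.par v) (t.children v : Set (Fin n)) :=
      t.neighborSet_toGraph hv
    have hr : v ≠ t.toLabelled.root := hv
    rw [LabelledTree.IsLeaf, this, Set.ncard_insert_of_notMem hp, Set.ncard_coe_finset]
    simp [hr]

theorem numLeaves_toLabelled {n : ℕ} (t : ParentTree (Fin n)) :
    t.toLabelled.numLeaves = t.numLeaves := by
  simp only [LabelledTree.numLeaves, numLeaves, isLeaf_toLabelled]

theorem IsIso.iso {n : ℕ} {s t : ParentTree (Fin n)} {e : Fin n ≃ Fin n} (h : IsIso s t e) :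
    LabelledTree.Iso s.toLabelled t.toLabelled := by
  refine ⟨⟨e, ?_⟩, h.root⟩
  intro v w
  change (e v ≠ e w ∧ (t.par (e v) = e w ∨ t.par (e w) = e v)) ↔
    (v ≠ w ∧ (s.par v = w ∨ s.par w = v))
  rw [← h.par, ← h.par, ne_eq, e.injective.eq_iff, e.injective.eq_iff, e.injective.eq_iff]

/-- An isomorphism of graphs that preserves the root respects the parent maps. -/
theorem exists_isIso_of_iso {n : ℕ} {s t : ParentTree (Fin n)}
    (h : LabelledTree.Iso s.toLabelled t.toLabelled) : ∃ e, IsIso s t e := by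
  obtain ⟨e, he⟩ := h
  have he' : e s.root = t.root := he
  refine ⟨e.toEquiv, he', fun v => ?_⟩
  change e (s.par v) = t.par (e v)
  induction v using s.par_induction with
  | h0 => rw [s.par_root, he', t.par_root]
  | h v hv ih =>
    have hadj : t.toGraph.Adj (e v) (e (s.par v)) := e.map_adj_iff.2 (s.toGraph_adj_par hv)
    rcases hadj.2 with h1 | h1
    · exact h1.symm
    · rw [← ih] at h1
      have h2 : s.par (s.par v) = v := e.injective h1
      have h3 := s.rank_par v hv
      by_cases h4 : s.par v = s.root
      · rw [h4, s.par_root] at h2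
        exact absurd h2.symm hv
      · have h5 := s.rank_par _ h4
        rw [h2] at h5
        omega

end ParentTree

/-- Every tree comes from a parent map: the parent of a vertex is its neighbour nearer to the
root. -/
theorem LabelledTree.exists_toLabelled_eq {n : ℕ} (t : LabelledTree n) :
    ∃ s : ParentTree (Fin n), s.toLabelled = t := by
  have hc := t.isTree.connected
  have key : ∀ v, ∃ w, (v = t.root → w = t.root) ∧
      (v ≠ t.root → t.graph.Adj v w ∧ t.graph.dist t.root w < t.graph.dist t.root v) := by
    intro v
    by_cases hv : v = t.root
    · exact ⟨t.root, fun _ => rfl, fun h => absurd hv h⟩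
    · obtain ⟨p, hp⟩ := hc.exists_walk_length_eq_dist v t.root
      cases p with
      | nil => exact absurd rfl hv
      | cons hadj q =>
        refine ⟨_, fun h => absurd h hv, fun _ => ⟨hadj, ?_⟩⟩
        have h1 := SimpleGraph.dist_le q
        rw [SimpleGraph.Walk.length_cons] at hp
        rw [SimpleGraph.dist_comm, SimpleGraph.dist_comm (u := t.root) (v := v)]
        omega
  choose p hp0 hp using key
  let s : ParentTree (Fin n) := ⟨t.root, p, t.graph.dist t.root, hp0 _ rfl, fun v hv => (hp v hv).2⟩
  have hle : s.toGraph ≤ t.graph := by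
    rintro v w ⟨hne, h | h⟩
    · have hv : v ≠ t.root := by
        rintro rfl
        exact hne (by rw [← h]; exact (hp0 _ rfl).symm)
      rw [← h]
      exact (hp v hv).1
    · have hw : w ≠ t.root := by
        rintro rfl
        exact hne (by rw [← h]; exact hp0 _ rfl)
      rw [← h]
      exact (hp w hw).1.symm
  -- Both graphs are trees on the same vertices, so they have equally many edges.
  have hg : s.toGraph = t.graph := by
    have h1 := (SimpleGraph.isTree_iff_connected_and_card.1 s.toGraph_isTree).2
    have h2 := (SimpleGraph.isTree_iff_connected_and_card.1 t.isTree).2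
    have h3 : s.toGraph.edgeSet = t.graph.edgeSet :=
      Set.eq_of_subset_of_ncard_le (SimpleGraph.edgeSet_mono hle) (by
        change Nat.card t.graph.edgeSet ≤ Nat.card s.toGraph.edgeSet
        omega) (Set.toFinite _)
    exact SimpleGraph.edgeSet_inj.1 h3
  refine ⟨s, ?_⟩
  obtain ⟨g, hgt, r⟩ := t
  simp only [ParentTree.toLabelled, LabelledTree.mk.injEq]
  exact ⟨hg, rfl⟩

/-! ### Unordered rooted trees as hereditary multisets -/

/-- The natural numbers that encode a rooted tree. -/
inductive IsCode : ℕ → Prop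
  | mk (M : Multiset ℕ) : (∀ c ∈ M, IsCode c) → IsCode (Encodable.encode M)

/-- Unordered rooted trees of all sizes. Such a tree is represented by the code of its root; what
matters is that, by `UTree.nodeEquiv`, a tree amounts to a multiset of trees. -/
def UTree : Type := {h : ℕ // IsCode h}

theorem ParentTree.isCode_code {V : Type} [Fintype V] (t : ParentTree V) (v : V) :
    IsCode (t.code v) := by
  induction v using t.children_induction with
  | h v ih =>
    rw [code_eq]
    refine IsCode.mk _ fun c hc => ?_
    obtain ⟨w, hw, rfl⟩ := Multiset.mem_map.1 hc
    exact ih w hw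

/-- The isomorphism class of a rooted tree. -/
noncomputable def ParentTree.toUTree {V : Type} [Fintype V] (t : ParentTree V) : UTree :=
  ⟨t.code t.root, t.isCode_code t.root⟩

namespace UTree

/-- The tree whose root has the given trees as children. -/
def node (M : Multiset UTree) : UTree :=
  ⟨Encodable.encode (M.map Subtype.val), IsCode.mk _ fun c hc => by
    obtain ⟨u, -, rfl⟩ := Multiset.mem_map.1 hc
    exact u.2⟩

theorem node_bijective : Function.Bijective node := by
  constructor
  · intro M M' h
    have h1 : M.map Subtype.val = M'.map Subtype.val :=
      Encodable.encode_injective (congrArg Subtype.val h)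
    exact Multiset.map_injective Subtype.val_injective h1
  · rintro ⟨_, ⟨M, hM⟩⟩
    lift M to Multiset {h : ℕ // IsCode h} using hM
    exact ⟨M, rfl⟩

/-- A tree amounts to the multiset of the subtrees that hang from the children of its root. -/
noncomputable def nodeEquiv : Multiset UTree ≃ UTree := Equiv.ofBijective node node_bijective

/-- The subtrees that hang from the children of the root. -/
noncomputable def children (u : UTree) : Multiset UTree := nodeEquiv.symm u

@[simp] theorem children_node (M : Multiset UTree) : (node M).children = M :=
  nodeEquiv.symm_apply_apply M

@[simp] theorem node_children (u : UTree) : node u.children = u :=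
  nodeEquiv.apply_symm_apply u

theorem toUTree_single : ParentTree.single.toUTree = node 0 := by
  apply Subtype.ext
  change ParentTree.single.code () = _
  rw [ParentTree.code_eq, ParentTree.children_single]
  rfl

theorem toUTree_graft {V W : Type} [Fintype V] [Fintype W] (s : ParentTree V) (t : ParentTree W) :
    (s.graft t).toUTree = node (s.toUTree ::ₘ t.toUTree.children) := by
  have h : (t.children t.root).val.map t.code = t.toUTree.children.map Subtype.val := by
    have h1 : t.toUTree = node t.toUTree.children := (node_children _).symm
    have h2 := congrArg Subtype.val h1
    change t.code t.root = _ at h2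
    rw [ParentTree.code_eq] at h2
    exact Encodable.encode_injective h2
  apply Subtype.ext
  change (s.graft t).code (s.graft t).root = _
  rw [ParentTree.code_graft, h]
  exact (congrArg Encodable.encode (Multiset.map_cons Subtype.val s.toUTree _)).symm

/-- Every hereditary multiset comes from a tree, which is built by successive grafting. -/
theorem exists_toUTree_eq (u : UTree) :
    ∃ (V : Type) (_ : Fintype V) (t : ParentTree V), t.toUTree = u := by
  obtain ⟨h, hu⟩ := u
  induction hu with
  | mk M hM ih =>
    have key : ∀ M' : Multiset UTree, (∀ c ∈ M', ∃ (V : Type) (_ : Fintype V) (t : ParentTree V),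
        t.toUTree = c) → ∃ (V : Type) (_ : Fintype V) (t : ParentTree V), t.toUTree = node M' := by
      intro M'
      induction M' using Multiset.induction_on with
      | empty => exact fun _ => ⟨Unit, inferInstance, _, toUTree_single⟩
      | cons c M' ih' =>
        intro hc
        obtain ⟨V, _, s, hs⟩ := hc c (Multiset.mem_cons_self _ _)
        obtain ⟨W, _, t, ht⟩ := ih' fun c' h' => hc c' (Multiset.mem_cons_of_mem h')
        exact ⟨V ⊕ W, inferInstance, s.graft t, by rw [toUTree_graft, hs, ht, children_node]⟩
    obtain ⟨M', hM'⟩ := node_bijective.2 ⟨_, IsCode.mk M hM⟩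
    rw [← hM']
    refine key M' fun c hc => ?_
    have h1 : M'.map Subtype.val = M := Encodable.encode_injective (congrArg Subtype.val hM')
    exact ih c.1 (h1 ▸ Multiset.mem_map_of_mem _ hc)

/-- The number of vertices. -/
noncomputable def size (u : UTree) : ℕ :=
  @Fintype.card u.exists_toUTree_eq.choose u.exists_toUTree_eq.choose_spec.choose

/-- The number of leaves; the root counts as one only in the one-vertex tree. -/
noncomputable def leaves (u : UTree) : ℕ :=
  letI := u.exists_toUTree_eq.choose_spec.choose
  u.exists_toUTree_eq.choose_spec.choose_spec.choose.numLeaves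

theorem size_leaves_toUTree {V : Type} [Fintype V] (t : ParentTree V) :
    t.toUTree.size = Fintype.card V ∧ t.toUTree.leaves = t.numLeaves := by
  set u := t.toUTree with hu
  let _ := u.exists_toUTree_eq.choose_spec.choose
  have h := u.exists_toUTree_eq.choose_spec.choose_spec.choose_spec
  obtain ⟨e, he⟩ := ParentTree.exists_isIso_of_code_eq t
    u.exists_toUTree_eq.choose_spec.choose_spec.choose (congrArg Subtype.val (hu.symm.trans h.symm))
  exact ⟨(Fintype.card_congr e).symm, he.numLeaves⟩

theorem size_pos (u : UTree) : 0 < u.size := by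
  obtain ⟨V, _, t, rfl⟩ := u.exists_toUTree_eq
  rw [(size_leaves_toUTree t).1]
  exact Fintype.card_pos_iff.2 ⟨t.root⟩

theorem size_node_zero : (node 0).size = 1 := by
  rw [← toUTree_single, (size_leaves_toUTree _).1]
  rfl

theorem leaves_node_zero : (node 0).leaves = 1 := by
  rw [← toUTree_single, (size_leaves_toUTree _).2, ParentTree.numLeaves_single]

theorem size_node_cons (c : UTree) (M : Multiset UTree) :
    (node (c ::ₘ M)).size = c.size + (node M).size := by
  obtain ⟨V, _, s, rfl⟩ := c.exists_toUTree_eq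
  obtain ⟨W, _, t, ht⟩ := (node M).exists_toUTree_eq
  have h : node (s.toUTree ::ₘ M) = (s.graft t).toUTree := by
    rw [toUTree_graft, ht, children_node]
  rw [h, ← ht, (size_leaves_toUTree _).1, (size_leaves_toUTree _).1, (size_leaves_toUTree _).1,
    Fintype.card_sum]

theorem size_node (M : Multiset UTree) : (node M).size = (M.map size).sum + 1 := by
  induction M using Multiset.induction_on with
  | empty => rw [size_node_zero]; rfl
  | cons c M ih => rw [size_node_cons, ih, Multiset.map_cons, Multiset.sum_cons, add_assoc]

theorem size_eq_one_iff (u : UTree) : u.size = 1 ↔ u = node 0 := by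
  constructor
  · intro h
    rw [← node_children u, size_node] at h
    rw [← node_children u]
    congr 1
    refine Multiset.eq_zero_of_forall_notMem fun c hc => ?_
    have h1 := Multiset.single_le_sum (fun _ _ => Nat.zero_le _) _ (Multiset.mem_map_of_mem size hc)
    have h2 := c.size_pos
    omega
  · rintro rfl
    exact size_node_zero

open Classical in
theorem leaves_node_cons (c : UTree) (M : Multiset UTree) :
    (node (c ::ₘ M)).leaves = c.leaves + if M = 0 then 0 else (node M).leaves := by
  obtain ⟨V, _, s, rfl⟩ := c.exists_toUTree_eq
  obtain ⟨W, _, t, ht⟩ := (node M).exists_toUTree_eq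
  have h : node (s.toUTree ::ₘ M) = (s.graft t).toUTree := by
    rw [toUTree_graft, ht, children_node]
  have h1 : Fintype.card W = 1 ↔ M = 0 := by
    rw [← (size_leaves_toUTree t).1, ht, size_eq_one_iff, node_bijective.1.eq_iff]
  rw [h, ← ht, (size_leaves_toUTree _).2, (size_leaves_toUTree _).2, (size_leaves_toUTree _).2,
    ParentTree.numLeaves_graft]
  simp only [h1]
  split_ifs <;> simp

theorem leaves_node {M : Multiset UTree} (hM : M ≠ 0) :
    (node M).leaves = (M.map leaves).sum := by
  induction M using Multiset.induction_on with
  | empty => exact absurd rfl hM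
  | cons c M ih =>
    rw [leaves_node_cons, Multiset.map_cons, Multiset.sum_cons]
    by_cases h : M = 0
    · simp [h]
    · rw [if_neg h, ih h]

end UTree

/-- The isomorphism class of a labelled tree. -/
noncomputable def LabelledTree.toUTree {n : ℕ} (t : LabelledTree n) : UTree :=
  t.exists_toLabelled_eq.choose.toUTree

theorem LabelledTree.toUTree_eq_iff {n : ℕ} (s t : LabelledTree n) :
    s.toUTree = t.toUTree ↔ Iso s t := by
  conv_rhs => rw [← s.exists_toLabelled_eq.choose_spec, ← t.exists_toLabelled_eq.choose_spec]
  constructor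
  · intro h
    obtain ⟨e, he⟩ := ParentTree.exists_isIso_of_code_eq _ _ (congrArg Subtype.val h)
    exact he.iso
  · intro h
    obtain ⟨e, he⟩ := ParentTree.exists_isIso_of_iso h
    apply Subtype.ext
    change ParentTree.code _ _ = ParentTree.code _ _
    rw [← he.code, he.root]

/-- The comparison map from unlabelled trees with `n` vertices to trees of all sizes. -/
noncomputable def UnlabelledTree.toUTree {n : ℕ} (c : UnlabelledTree n) : UTree :=
  Quotient.lift LabelledTree.toUTree (fun s t h => (LabelledTree.toUTree_eq_iff s t).2 h) c

theorem UnlabelledTree.toUTree_injective {n : ℕ} :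
    Function.Injective (UnlabelledTree.toUTree (n := n)) := by
  intro c c'
  induction c using Quotient.inductionOn
  induction c' using Quotient.inductionOn
  intro h
  exact Quotient.sound ((LabelledTree.toUTree_eq_iff _ _).1 h)

theorem UnlabelledTree.leaves_toUTree {n : ℕ} (c : UnlabelledTree n) :
    c.toUTree.leaves = c.numLeaves := by
  induction c using Quotient.inductionOn with
  | _ t =>
    change t.exists_toLabelled_eq.choose.toUTree.leaves = t.numLeaves
    rw [(UTree.size_leaves_toUTree _).2, ← ParentTree.numLeaves_toLabelled,
      t.exists_toLabelled_eq.choose_spec]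

theorem UnlabelledTree.range_toUTree (n : ℕ) :
    Set.range (UnlabelledTree.toUTree (n := n)) = {u | u.size = n} := by
  ext u
  constructor
  · rintro ⟨c, rfl⟩
    induction c using Quotient.inductionOn with
    | _ t =>
      change t.exists_toLabelled_eq.choose.toUTree.size = n
      rw [(UTree.size_leaves_toUTree _).1, Fintype.card_fin]
  · intro hu
    obtain ⟨V, _, t, rfl⟩ := u.exists_toUTree_eq
    have hcard : Fintype.card V = n := by rw [← (UTree.size_leaves_toUTree t).1]; exact hu
    obtain ⟨e⟩ : Nonempty (V ≃ Fin n) := ⟨Fintype.equivFinOfCardEq hcard⟩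
    set s := t.relabel e with hs
    have hst : s.toUTree = t.toUTree := by
      apply Subtype.ext
      change s.code s.root = t.code t.root
      rw [← (t.isIso_relabel e).root, (t.isIso_relabel e).code]
    refine ⟨Quotient.mk _ s.toLabelled, ?_⟩
    rw [← hst]
    change s.toLabelled.exists_toLabelled_eq.choose.toUTree = s.toUTree
    obtain ⟨f, hf⟩ := ParentTree.exists_isIso_of_iso (s := s)
      (t := s.toLabelled.exists_toLabelled_eq.choose)
      (by rw [s.toLabelled.exists_toLabelled_eq.choose_spec]; exact LabelledTree.Iso.refl _)
    apply Subtype.ext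
    change ParentTree.code _ _ = ParentTree.code _ _
    rw [← hf.code, hf.root]

/-! ### Counting trees -/

noncomputable instance : DecidableEq UTree := Classical.decEq _

instance (n : ℕ) : Finite (UnlabelledTree n) := by
  have : Finite (LabelledTree n) :=
    Finite.of_injective (fun t : LabelledTree n => (t.graph, t.root)) fun s t h => by
      cases s; cases t; simp_all
  exact Quotient.finite _

/-- The trees with `n` vertices. -/
noncomputable def trees (n : ℕ) : Finset UTree :=
  (Set.finite_range (UnlabelledTree.toUTree (n := n))).toFinset

@[simp] theorem mem_trees {n : ℕ} {u : UTree} : u ∈ trees n ↔ u.size = n := by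
  rw [trees, Set.Finite.mem_toFinset, UnlabelledTree.range_toUTree]
  rfl

theorem card_unlabelledTree (n : ℕ) (P : ℕ → Prop) [DecidablePred P] :
    Nat.card {c : UnlabelledTree n // P c.numLeaves} =
      ((trees n).filter fun u => P u.leaves).card := by
  have h : (((trees n).filter fun u => P u.leaves : Finset UTree) : Set UTree) =
      UnlabelledTree.toUTree '' {c : UnlabelledTree n | P c.numLeaves} := by
    ext u
    simp only [Finset.coe_filter, mem_trees, Set.mem_ofPred_eq, Set.mem_image]
    constructor
    · rintro ⟨h1, h2⟩
      have h3 : u ∈ Set.range (UnlabelledTree.toUTree (n := n)) := by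
        rw [UnlabelledTree.range_toUTree]; exact h1
      obtain ⟨c, rfl⟩ := h3
      exact ⟨c, by rwa [← c.leaves_toUTree], rfl⟩
    · rintro ⟨c, h1, rfl⟩
      have h3 : c.toUTree ∈ Set.range (UnlabelledTree.toUTree (n := n)) := ⟨c, rfl⟩
      rw [UnlabelledTree.range_toUTree] at h3
      exact ⟨h3, by rwa [c.leaves_toUTree]⟩
  rw [← Set.ncard_coe_finset, h, Set.ncard_image_of_injective _ UnlabelledTree.toUTree_injective]
  rfl

theorem a_eq_card (n k : ℕ) : a n k = ((trees n).filter fun u => u.leaves = k).card :=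
  card_unlabelledTree n fun l => l = k

theorem L_eq_card (d : ℕ) :
    L d = ((trees (N d)).filter fun u => K d ≤ (u.leaves : ℤ)).card :=
  card_unlabelledTree (N d) fun l => K d ≤ (l : ℤ)

namespace UTree

/-- The tree obtained from `u` by hanging `c` from a new child of the root. -/
noncomputable def addChild (c u : UTree) : UTree := node (c ::ₘ u.children)

theorem size_addChild (c u : UTree) : (addChild c u).size = c.size + u.size := by
  rw [addChild, size_node_cons, node_children]

theorem leaves_addChild (c : UTree) {u : UTree} (hu : u.size ≠ 1) :
    (addChild c u).leaves = c.leaves + u.leaves := by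
  rw [addChild, leaves_node_cons, node_children, if_neg]
  intro h
  apply hu
  rw [size_eq_one_iff, ← node_children u, h]

theorem children_addChild (c u : UTree) : (addChild c u).children = c ::ₘ u.children :=
  children_node _

theorem children_injective : Function.Injective children := nodeEquiv.symm.injective

theorem addChild_injective (c : UTree) : Function.Injective (addChild c) := by
  intro u v h
  apply children_injective
  have := congrArg children h
  rwa [children_addChild, children_addChild, Multiset.cons_inj_right] at this

theorem exists_addChild_eq {u : UTree} (hu : u.size ≠ 1) : ∃ c v, addChild c v = u := by
  rcases Multiset.empty_or_exists_mem u.children with h | ⟨c, hc⟩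
  · exact absurd ((size_eq_one_iff u).2 (by rw [← h, node_children])) hu
  · obtain ⟨M, hM⟩ := Multiset.exists_cons_of_mem hc
    exact ⟨c, node M, by rw [addChild, children_node, ← hM, node_children]⟩

theorem size_singleton (u : UTree) : (node {u}).size = u.size + 1 := by
  rw [size_node, Multiset.map_singleton, Multiset.sum_singleton]

theorem leaves_singleton (u : UTree) : (node {u}).leaves = u.leaves := by
  rw [leaves_node (Multiset.singleton_ne_zero u), Multiset.map_singleton, Multiset.sum_singleton]

theorem leaves_le_size (u : UTree) : u.leaves ≤ u.size := by
  obtain ⟨V, _, t, rfl⟩ := u.exists_toUTree_eq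
  rw [(size_leaves_toUTree t).1, (size_leaves_toUTree t).2, ← Nat.card_eq_fintype_card,
    ParentTree.numLeaves]
  exact Set.ncard_le_card _

end UTree

open UTree

theorem trees_zero : trees 0 = ∅ := by
  ext u
  have := u.size_pos
  simp; omega

theorem trees_one : trees 1 = {node 0} := by
  ext u
  simp [size_eq_one_iff]

theorem card_trees_le_succ (n : ℕ) : (trees n).card ≤ (trees (n + 1)).card := by
  refine Finset.card_le_card_of_injOn (addChild (node 0)) ?_ (addChild_injective _).injOn
  intro u hu
  rw [Finset.mem_coe, mem_trees] at hu
  rw [Finset.mem_coe, mem_trees, size_addChild, size_node_zero, hu, add_comm]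

/-- A tree on `n` vertices yields two on `n + 1`: one by adding a leaf at the root, one by
planting. The former has a root with several children, the latter has not. -/
theorem two_mul_card_trees_le {n : ℕ} (hn : 2 ≤ n) :
    2 * (trees n).card ≤ (trees (n + 1)).card := by
  have h1 : Function.Injective fun u : UTree => node {u} := fun u v h =>
    Multiset.singleton_inj.1 (node_bijective.1 h)
  have hd : Disjoint ((trees n).image (addChild (node 0))) ((trees n).image fun u => node {u}) := by
    rw [Finset.disjoint_left]
    intro x hx hx'
    obtain ⟨u, hu, rfl⟩ := Finset.mem_image.1 hx
    obtain ⟨v, hv, hvu⟩ := Finset.mem_image.1 hx'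
    have h2 := congrArg (fun u => Multiset.card u.children) hvu
    simp only [children_addChild, children_node, Multiset.card_singleton, Multiset.card_cons] at h2
    have h3 : u.children = 0 := by
      rw [← Multiset.card_eq_zero]; omega
    have h4 : u.size = 1 := (size_eq_one_iff u).2 (by rw [← h3, node_children])
    rw [mem_trees] at hu
    omega
  rw [two_mul]
  nth_rw 1 [← Finset.card_image_of_injective (trees n) (addChild_injective (node 0))]
  rw [← Finset.card_image_of_injective (trees n) h1, ← Finset.card_union_of_disjoint hd]
  refine Finset.card_le_card (Finset.union_subset ?_ ?_)
  · intro x hx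
    obtain ⟨u, hu, rfl⟩ := Finset.mem_image.1 hx
    rw [mem_trees] at hu ⊢
    rw [size_addChild, size_node_zero, hu, add_comm]
  · intro x hx
    obtain ⟨u, hu, rfl⟩ := Finset.mem_image.1 hx
    rw [mem_trees] at hu ⊢
    rw [size_singleton, hu]

theorem sum_card_trees_le {n : ℕ} (hn : 2 ≤ n) :
    ∑ j ∈ Finset.range n, (trees j).card ≤ (trees n).card := by
  induction n, hn using Nat.le_induction with
  | base =>
    rw [Finset.sum_range_succ, Finset.sum_range_one, trees_zero, Finset.card_empty, zero_add]
    exact card_trees_le_succ 1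
  | succ n hn ih =>
    rw [Finset.sum_range_succ]
    have := two_mul_card_trees_le hn
    omega

theorem two_pow_le_card_trees (n : ℕ) : 2 ^ n ≤ (trees (n + 2)).card := by
  induction n with
  | zero => simpa [trees_one] using card_trees_le_succ 1
  | succ n ih =>
    have := two_mul_card_trees_le (n := n + 2) (by omega)
    rw [pow_succ]
    change _ ≤ (trees (n + 2 + 1)).card
    omega

/-! ### The mean number of leaves -/

/-- Removing `j` copies of `c` at the root matches the trees that have them with all trees of the
remaining size. -/
theorem card_filter_le_count (n j : ℕ) (c : UTree) :
    ((trees n).filter fun u => j ≤ u.children.count c).card = (trees (n - j * c.size)).card := by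
  have hsize : ∀ M : Multiset UTree,
      (node (M + Multiset.replicate j c)).size = (node M).size + j * c.size := by
    intro M
    rw [size_node, size_node, Multiset.map_add, Multiset.sum_add, Multiset.map_replicate,
      Multiset.sum_replicate, smul_eq_mul]
    omega
  have hinj : Function.Injective fun v : UTree => node (v.children + Multiset.replicate j c) :=
    fun u v h => children_injective (add_right_cancel (node_bijective.1 h))
  rw [← Finset.card_image_of_injective (trees (n - j * c.size)) hinj]
  congr 1
  ext u
  simp only [Finset.mem_filter, mem_trees, Finset.mem_image]
  constructor
  · rintro ⟨h1, h2⟩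
    have h3 := Multiset.sub_add_cancel (Multiset.le_count_iff_replicate_le.1 h2)
    refine ⟨node (u.children - Multiset.replicate j c), ?_, ?_⟩
    · have h4 := hsize (u.children - Multiset.replicate j c)
      rw [h3, node_children, h1] at h4
      omega
    · rw [children_node, h3, node_children]
  · rintro ⟨v, h1, rfl⟩
    have h2 := v.size_pos
    rw [hsize, node_children, children_node]
    refine ⟨by omega, ?_⟩
    simp

/-- Twice the number of leaves, less the number of vertices. -/
noncomputable def UTree.excess (u : UTree) : ℤ := 2 * u.leaves - u.size

theorem UTree.excess_eq {u : UTree} (hu : u.size ≠ 1) :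
    u.excess = (u.children.map UTree.excess).sum - 1 := by
  have h0 : u.children ≠ 0 := fun h => hu ((size_eq_one_iff u).2 (by rw [← h, node_children]))
  have h1 : ∀ M : Multiset UTree, (M.map UTree.excess).sum =
      2 * ((M.map leaves).sum : ℤ) - ((M.map size).sum : ℤ) := by
    intro M
    induction M using Multiset.induction_on with
    | empty => simp
    | cons c M ih =>
      simp only [Multiset.map_cons, Multiset.sum_cons, ih, excess, Nat.cast_add]
      ring
  have h2 := leaves_node h0
  have h3 := size_node u.children
  rw [node_children] at h2 h3
  rw [h1, excess, h2, h3]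
  push_cast
  ring

theorem UTree.size_lt_of_mem_children {c u : UTree} (h : c ∈ u.children) : c.size < u.size := by
  have h1 := size_node u.children
  rw [node_children] at h1
  have h2 := Multiset.single_le_sum (fun _ _ => Nat.zero_le _) _ (Multiset.mem_map_of_mem size h)
  omega

theorem UTree.card_children_lt_size (u : UTree) : Multiset.card u.children < u.size := by
  have h1 := size_node u.children
  rw [node_children] at h1
  have h2 : Multiset.card u.children ≤ (u.children.map size).sum := by
    have := Multiset.card_nsmul_le_sum (s := u.children.map size) (a := 1) (by
      intro x hx
      obtain ⟨c, -, rfl⟩ := Multiset.mem_map.1 hx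
      exact c.size_pos)
    simpa using this
  omega

theorem sum_map_children {n : ℕ} {u : UTree} (hu : u.size = n) (f : UTree → ℤ) :
    (u.children.map f).sum = ∑ m ∈ Finset.range n, ∑ c ∈ trees m, ∑ j ∈ Finset.range n,
      if j + 1 ≤ u.children.count c then f c else 0 := by
  have hdisj : (Finset.range n : Set ℕ).PairwiseDisjoint trees := by
    intro i _ j _ hij
    rw [Function.onFun, Finset.disjoint_left]
    intro x hx hx'
    rw [mem_trees] at hx hx'
    exact hij (hx.symm.trans hx')
  rw [← Finset.sum_biUnion hdisj, Finset.sum_multiset_map_count]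
  have hsub : u.children.toFinset ⊆ (Finset.range n).biUnion trees := by
    intro c hc
    rw [Multiset.mem_toFinset] at hc
    simp only [Finset.mem_biUnion, Finset.mem_range, mem_trees, exists_eq_right']
    exact hu ▸ UTree.size_lt_of_mem_children hc
  rw [Finset.sum_subset hsub]
  · refine Finset.sum_congr rfl fun c _ => ?_
    have h1 := u.card_children_lt_size
    have h2 := Multiset.count_le_card c u.children
    rw [← Finset.sum_filter, Finset.sum_const]
    congr 1
    have : (Finset.range n).filter (fun j => j + 1 ≤ u.children.count c) =
        Finset.range (u.children.count c) := by
      ext j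
      simp only [Finset.mem_filter, Finset.mem_range]
      omega
    rw [this, Finset.card_range]
  · intro c _ hc
    rw [Multiset.mem_toFinset] at hc
    simp [Multiset.count_eq_zero_of_notMem hc]

/-- The recursion for the total excess of the trees with `n` vertices; on generating functions it
is the logarithmic derivative of `exp (∑ T(x^j) / j)`. -/
theorem sum_excess_eq {n : ℕ} (hn : 2 ≤ n) :
    ∑ u ∈ trees n, u.excess = ∑ m ∈ Finset.range n, (∑ c ∈ trees m, c.excess) *
      (∑ j ∈ Finset.range n, ((trees (n - (j + 1) * m)).card : ℤ)) - (trees n).card := by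
  have h1 : ∀ u ∈ trees n, u.excess = (∑ m ∈ Finset.range n, ∑ c ∈ trees m,
      ∑ j ∈ Finset.range n, if j + 1 ≤ u.children.count c then c.excess else 0) - 1 := by
    intro u hu
    rw [mem_trees] at hu
    rw [UTree.excess_eq (by omega), sum_map_children hu]
  rw [Finset.sum_congr rfl h1, Finset.sum_sub_distrib, Finset.sum_const, nsmul_one]
  congr 1
  rw [Finset.sum_comm]
  refine Finset.sum_congr rfl fun m _ => ?_
  rw [Finset.sum_comm, Finset.sum_mul]
  refine Finset.sum_congr rfl fun c hc => ?_
  rw [Finset.sum_comm, Finset.mul_sum]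
  refine Finset.sum_congr rfl fun j _ => ?_
  rw [← (mem_trees.1 hc), ← card_filter_le_count n (j + 1) c, ← Finset.sum_filter,
    Finset.sum_const, nsmul_eq_mul, mul_comm]

/-- On average, at most half of the vertices of a tree are leaves. -/
theorem sum_excess_nonpos {n : ℕ} (hn : 2 ≤ n) : ∑ u ∈ trees n, u.excess ≤ 0 := by
  induction n using Nat.strong_induction_on with
  | _ n ih =>
    rw [sum_excess_eq hn, sub_nonpos]
    have hone : ∑ c ∈ trees 1, c.excess = 1 := by
      rw [trees_one, Finset.sum_singleton, UTree.excess, size_node_zero, leaves_node_zero]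
      norm_num
    have h1 : ∑ m ∈ Finset.range n, (∑ c ∈ trees m, c.excess) *
        (∑ j ∈ Finset.range n, ((trees (n - (j + 1) * m)).card : ℤ)) ≤
        ∑ m ∈ Finset.range n, if m = 1 then
          (∑ j ∈ Finset.range n, ((trees (n - (j + 1))).card : ℤ)) else 0 := by
      refine Finset.sum_le_sum fun m hm => ?_
      rw [Finset.mem_range] at hm
      split_ifs with h
      · subst h
        simp [hone]
      · rcases Nat.eq_zero_or_pos m with rfl | hpos
        · simp [trees_zero]
        · exact mul_nonpos_of_nonpos_of_nonneg (ih m hm (by omega))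
            (Finset.sum_nonneg fun _ _ => Nat.cast_nonneg _)
    refine h1.trans ?_
    rw [Finset.sum_ite_eq' , if_pos (Finset.mem_range.2 (by omega))]
    have h2 : ∑ j ∈ Finset.range n, (trees (n - (j + 1))).card =
        ∑ j ∈ Finset.range n, (trees j).card := by
      rw [← Finset.sum_range_reflect (fun j => (trees j).card)]
      refine Finset.sum_congr rfl fun j _ => ?_
      rw [Nat.sub_sub, add_comm 1 j]
    rw [← Nat.cast_sum, h2]
    exact_mod_cast sum_card_trees_le hn

/-! ### Bounds for the counts -/

theorem card_trees_le_catalan (n : ℕ) : (trees (n + 1)).card ≤ catalan n := by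
  induction n using Nat.strong_induction_on with
  | _ n ih =>
    cases n with
    | zero => simp [trees_one]
    | succ n =>
      rw [catalan_succ']
      have hsub : trees (n + 2) ⊆ (Finset.HasAntidiagonal.antidiagonal n).biUnion fun p =>
          (trees (p.1 + 1) ×ˢ trees (p.2 + 1)).image fun q => addChild q.1 q.2 := by
        intro u hu
        rw [mem_trees] at hu
        obtain ⟨c, v, rfl⟩ := exists_addChild_eq (u := u) (by omega)
        rw [size_addChild] at hu
        have h1 := c.size_pos
        have h2 := v.size_pos
        simp only [Finset.mem_biUnion, Finset.mem_image, Finset.mem_product, mem_trees,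
          Finset.HasAntidiagonal.mem_antidiagonal]
        exact ⟨(c.size - 1, v.size - 1), by simp only; omega, (c, v),
          ⟨by simp only; omega, by simp only; omega⟩, rfl⟩
      refine (Finset.card_le_card hsub).trans (Finset.card_biUnion_le.trans ?_)
      refine Finset.sum_le_sum fun p hp => Finset.card_image_le.trans ?_
      rw [Finset.HasAntidiagonal.mem_antidiagonal] at hp
      rw [Finset.card_product]
      exact Nat.mul_le_mul (ih _ (by omega)) (ih _ (by omega))

theorem card_trees_le (n : ℕ) : (trees n).card ≤ 4 ^ n := by
  cases n with
  | zero => simp [trees_zero]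
  | succ n =>
    calc (trees (n + 1)).card ≤ catalan n := card_trees_le_catalan n
      _ ≤ Nat.centralBinom n := by
        rw [catalan_eq_centralBinom_div]
        exact Nat.div_le_self _ _
      _ ≤ 2 ^ (2 * n) := by
        rw [Nat.centralBinom]
        exact Nat.choose_le_two_pow _ _
      _ = 4 ^ n := by rw [pow_mul]; norm_num
      _ ≤ 4 ^ (n + 1) := Nat.pow_le_pow_right (by norm_num) (Nat.le_succ n)

theorem a_le_card_trees (n k : ℕ) : a n k ≤ (trees n).card := by
  rw [a_eq_card]
  exact Finset.card_filter_le _ _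

theorem a_eq_zero_of_lt {n k : ℕ} (h : n < k) : a n k = 0 := by
  rw [a_eq_card, Finset.card_eq_zero, Finset.filter_eq_empty_iff]
  intro u hu hk
  have := u.leaves_le_size
  rw [mem_trees.1 hu, hk] at this
  omega

theorem a_pos_iff {n k : ℕ} : 0 < a n k ↔ ∃ u : UTree, u.size = n ∧ u.leaves = k := by
  rw [a_eq_card, Finset.card_pos]
  simp [Finset.Nonempty]

/-- Paths. -/
theorem a_succ_one_pos (n : ℕ) : 0 < a (n + 1) 1 := by
  rw [a_pos_iff]
  induction n with
  | zero => exact ⟨node 0, size_node_zero, leaves_node_zero⟩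
  | succ n ih =>
    obtain ⟨u, h1, h2⟩ := ih
    exact ⟨node {u}, by rw [size_singleton, h1], by rw [leaves_singleton, h2]⟩

/-- Stars. -/
theorem a_star_pos {n : ℕ} (hn : 0 < n) : 0 < a (n + 1) n := by
  rw [a_pos_iff]
  refine ⟨node (Multiset.replicate n (node 0)), ?_, ?_⟩
  · rw [size_node, Multiset.map_replicate, Multiset.sum_replicate, size_node_zero, smul_eq_mul,
      mul_one]
  · have : Multiset.replicate n (node 0) ≠ 0 := by
      rw [ne_eq, ← Multiset.card_eq_zero, Multiset.card_replicate]
      omega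
    rw [leaves_node this, Multiset.map_replicate, Multiset.sum_replicate, leaves_node_zero,
      smul_eq_mul, mul_one]

/-- An ordered pair of trees `u`, `v` can be read off from the tree whose root has two children,
one with the only child `u` and one with `v` and a leaf as children. -/
noncomputable def UTree.pair (u v : UTree) : UTree := node {node {u}, node {v, node 0}}

theorem UTree.size_pair (u v : UTree) : (pair u v).size = u.size + v.size + 4 := by
  simp only [pair, size_node, Multiset.insert_eq_cons, Multiset.map_cons, Multiset.map_singleton,
    Multiset.sum_cons, Multiset.sum_singleton, Multiset.map_zero, Multiset.sum_zero]
  omega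

theorem UTree.leaves_pair (u v : UTree) : (pair u v).leaves = u.leaves + v.leaves + 1 := by
  have h : ∀ x y : UTree, (node {x, y}).leaves = x.leaves + y.leaves := by
    intro x y
    rw [leaves_node (by simp)]
    simp
  rw [pair, h, h, leaves_singleton, leaves_node_zero, add_assoc]

theorem UTree.pair_injective : Function.Injective fun p : UTree × UTree => pair p.1 p.2 := by
  rintro ⟨u, v⟩ ⟨u', v'⟩ h
  have hne : ∀ x y : UTree, node {x} ≠ node {y, node 0} := by
    intro x y hxy
    have := congrArg Multiset.card (node_bijective.1 hxy)
    simp at this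
  have h1 := node_bijective.1 h
  simp only [Multiset.insert_eq_cons, Multiset.cons_eq_cons] at h1
  rcases h1 with ⟨h1, h2⟩ | ⟨-, cs, h1, -⟩
  · have h3 := Multiset.singleton_inj.1 (node_bijective.1 h1)
    have h4 := node_bijective.1 (Multiset.singleton_inj.1 h2)
    rw [Multiset.cons_inj_left] at h4
    rw [h3, h4]
  · have h2 : node {u'} ∈ ({node {v, node 0}} : Multiset UTree) := by
      rw [Multiset.insert_eq_cons, h1]
      exact Multiset.mem_cons_self _ _
    exact absurd (Multiset.mem_singleton.1 h2) (hne _ _)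

theorem a_mul_a_le (n₁ k₁ n₂ k₂ : ℕ) :
    a n₁ k₁ * a n₂ k₂ ≤ a (n₁ + n₂ + 4) (k₁ + k₂ + 1) := by
  rw [a_eq_card, a_eq_card, a_eq_card, ← Finset.card_product]
  refine Finset.card_le_card_of_injOn (fun p => pair p.1 p.2) ?_ pair_injective.injOn
  rintro ⟨u, v⟩ h
  simp only [Finset.coe_product, Set.mem_prod, Finset.mem_coe, Finset.mem_filter, mem_trees] at h ⊢
  rw [size_pair, leaves_pair, h.1.1, h.1.2, h.2.1, h.2.2]
  exact ⟨rfl, rfl⟩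

/-- Leaves may be added at the root. -/
theorem a_le_card_filter {n k j N' : ℕ} (hn : 2 ≤ n) (hN : n + j = N') {K' : ℤ}
    (hK : K' ≤ ((k + j : ℕ) : ℤ)) :
    a n k ≤ ((trees N').filter fun u => K' ≤ (u.leaves : ℤ)).card := by
  rw [a_eq_card]
  have hit : ∀ u : UTree, u.size ≠ 1 → ((addChild (node 0))^[j] u).size = u.size + j ∧
      ((addChild (node 0))^[j] u).leaves = u.leaves + j := by
    intro u hu
    induction j generalizing N' K' with
    | zero => exact ⟨rfl, rfl⟩
    | succ j ih =>
      obtain ⟨h1, h2⟩ := ih rfl le_rfl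
      have := u.size_pos
      rw [Function.iterate_succ_apply', size_addChild, leaves_addChild _ (by omega), h1, h2,
        size_node_zero, leaves_node_zero]
      omega
  refine Finset.card_le_card_of_injOn ((addChild (node 0))^[j]) ?_
    ((addChild_injective _).iterate j).injOn
  intro u hu
  simp only [Finset.mem_coe, Finset.mem_filter, mem_trees] at hu ⊢
  obtain ⟨h1, h2⟩ := hit u (by omega)
  rw [h1, h2, hu.1, hu.2]
  exact ⟨hN, hK⟩

/-! ### The domain of convergence -/

theorem le_one_of_pow_le {ρ C : ℝ} (h : ∀ n : ℕ, 2 ≤ n → ρ ^ n ≤ C * (n + 1)) : ρ ≤ 1 := by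
  by_contra! hρ
  have h1 := tendsto_pow_const_div_const_pow_of_one_lt 1 hρ
  have h2 := tendsto_pow_const_div_const_pow_of_one_lt 0 hρ
  have h3 : Tendsto (fun n : ℕ => C * ((n : ℝ) ^ 1 / ρ ^ n + (n : ℝ) ^ 0 / ρ ^ n)) atTop
      (nhds 0) := by
    simpa using (h1.add h2).const_mul C
  obtain ⟨n, hn, hn2⟩ := ((h3.eventually_lt_const one_pos).and (eventually_ge_atTop 2)).exists
  have hpos : 0 < ρ ^ n := by positivity
  rw [pow_one, pow_zero, ← add_div, ← mul_div_assoc, div_lt_one hpos] at hn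
  exact absurd (h n hn2) (not_le.2 hn)

theorem exists_bound_of_mem {x : ℂ} {ζ : ℝ} (hζ : 0 < ζ) (h : (x, (ζ : ℂ)) ∈ convergenceDomain) :
    ∃ C : ℝ, 0 < C ∧ ∀ n k, (a n k : ℝ) * ‖x‖ ^ n * ζ ^ k ≤ C := by
  have h1 : (x, (ζ : ℂ)) ∈ {p : ℂ × ℂ | Summable fun q : ℕ × ℕ =>
      (a q.1 q.2 : ℂ) * p.1 ^ q.1 * p.2 ^ q.2} := interior_subset h
  have h2 := Summable.norm h1
  have h3 : ∀ q : ℕ × ℕ, ‖(a q.1 q.2 : ℂ) * x ^ q.1 * (ζ : ℂ) ^ q.2‖ =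
      (a q.1 q.2 : ℝ) * ‖x‖ ^ q.1 * ζ ^ q.2 := by
    intro q
    rw [norm_mul, norm_mul, norm_pow, norm_pow, Complex.norm_natCast, Complex.norm_real,
      Real.norm_of_nonneg hζ.le]
  simp only [h3] at h2
  have h4 : ∀ q : ℕ × ℕ, 0 ≤ (a q.1 q.2 : ℝ) * ‖x‖ ^ q.1 * ζ ^ q.2 := fun q => by positivity
  refine ⟨(∑' q : ℕ × ℕ, (a q.1 q.2 : ℝ) * ‖x‖ ^ q.1 * ζ ^ q.2) + 1, ?_, fun n k => ?_⟩
  · have := tsum_nonneg (L := .unconditional _) h4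
    linarith
  · have := h2.le_tsum (n, k) fun q _ => h4 q
    simp only at this
    linarith

/-- Bounded terms give convergence in a neighbourhood of every point with a smaller first
coordinate, because `a n k` vanishes for `k > n`. -/
theorem mem_of_bound {ρ ζ C ρ' : ℝ} (hζ : 0 < ζ) (hC : ∀ n k, (a n k : ℝ) * ρ ^ n * ζ ^ k ≤ C)
    (hρ' : 0 ≤ ρ') (hlt : ρ' < ρ) : ((ρ' : ℂ), (ζ : ℂ)) ∈ convergenceDomain := by
  have hρ : 0 < ρ := hρ'.trans_lt hlt
  have hC0 : 0 ≤ C := le_trans (by positivity) (hC 0 0)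
  set q := (ρ' + ρ) / 2 / ρ with hq
  have hq0 : 0 < q := by positivity
  have hq1 : q < 1 := by
    rw [hq, div_lt_one hρ]; linarith
  set η := 2 / (1 + q) with hη
  have hη1 : 1 < η := by
    rw [hη, lt_div_iff₀ (by positivity)]; linarith
  have hqη : q * η < 1 := by
    rw [hη, ← mul_div_assoc, div_lt_one (by positivity)]; linarith
  set τ := Real.sqrt (q * η) with hτ
  have hτ0 : 0 ≤ τ := Real.sqrt_nonneg _
  have hτ2 : τ ^ 2 = q * η := Real.sq_sqrt (by positivity)
  have hτ1 : τ < 1 := by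
    rw [hτ, Real.sqrt_lt' one_pos]; simpa using hqη
  have hsum : Summable fun p : ℕ × ℕ => C * (τ ^ p.1 * τ ^ p.2) := by
    have := summable_geometric_of_lt_one hτ0 hτ1
    exact (this.mul_of_nonneg this (fun _ => by positivity) (fun _ => by positivity)).mul_left C
  refine mem_interior.2 ⟨{p : ℂ × ℂ | ‖p.1‖ < ρ * q ∧ ‖p.2‖ < ζ * η}, ?_, ?_, ?_, ?_⟩
  · rintro ⟨x, z⟩ ⟨hx, hz⟩
    refine Summable.of_norm_bounded hsum ?_
    rintro ⟨n, k⟩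
    simp only at hx hz ⊢
    rcases lt_or_ge n k with hnk | hnk
    · rw [a_eq_zero_of_lt hnk]
      simp only [Nat.cast_zero, zero_mul, norm_zero]
      positivity
    · rw [norm_mul, norm_mul, norm_pow, norm_pow, Complex.norm_natCast]
      calc (a n k : ℝ) * ‖x‖ ^ n * ‖z‖ ^ k ≤ (a n k : ℝ) * (ρ * q) ^ n * (ζ * η) ^ k := by
            gcongr
        _ = (a n k : ℝ) * ρ ^ n * ζ ^ k * (q ^ n * η ^ k) := by
            rw [mul_pow, mul_pow]; ring
        _ ≤ C * (q ^ n * η ^ n) := by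
            have := hC n k
            have h2 : η ^ k ≤ η ^ n := pow_le_pow_right₀ hη1.le hnk
            gcongr
        _ = C * (τ ^ n * τ ^ n) := by
            rw [← mul_pow, ← hτ2]; ring
        _ ≤ C * (τ ^ n * τ ^ k) := by
            have h2 : τ ^ n ≤ τ ^ k := pow_le_pow_of_le_one hτ0 hτ1.le hnk
            gcongr
  · exact (isOpen_lt continuous_fst.norm continuous_const).inter
      (isOpen_lt continuous_snd.norm continuous_const)
  · simp only [Complex.norm_real, Real.norm_of_nonneg hρ']
    rw [hq, mul_div_cancel₀ _ hρ.ne']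
    linarith
  · simp only [Complex.norm_real, Real.norm_of_nonneg hζ.le]
    nlinarith

theorem norm_le_one_of_mem {x : ℂ} {ζ : ℝ} (hζ : 0 < ζ) (h : (x, (ζ : ℂ)) ∈ convergenceDomain) :
    ‖x‖ ≤ 1 := by
  obtain ⟨C, hC0, hC⟩ := exists_bound_of_mem hζ h
  refine le_one_of_pow_le (C := C / ζ) fun n hn => ?_
  obtain ⟨m, rfl⟩ : ∃ m, n = m + 1 := ⟨n - 1, by omega⟩
  have h1 := hC (m + 1) 1
  have h2 : (1 : ℝ) ≤ a (m + 1) 1 := by exact_mod_cast a_succ_one_pos m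
  have h3 : ‖x‖ ^ (m + 1) ≤ C / ζ := by
    rw [le_div_iff₀ hζ]
    rw [pow_one] at h1
    refine le_trans ?_ h1
    have : 0 ≤ ‖x‖ ^ (m + 1) := by positivity
    have := mul_le_mul_of_nonneg_right h2 this
    rw [one_mul] at this
    gcongr
  refine h3.trans (le_mul_of_one_le_right (by positivity) ?_)
  have : (0 : ℝ) ≤ ((m + 1 : ℕ) : ℝ) := Nat.cast_nonneg _
  linarith

theorem norm_mul_le_one_of_mem {x : ℂ} {ζ : ℝ} (hζ : 0 < ζ)
    (h : (x, (ζ : ℂ)) ∈ convergenceDomain) : ‖x‖ * ζ ≤ 1 := by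
  rcases eq_or_lt_of_le (norm_nonneg x) with hx | hx
  · rw [← hx]; simp
  obtain ⟨C, hC0, hC⟩ := exists_bound_of_mem hζ h
  refine le_one_of_pow_le (C := C / ‖x‖) fun n hn => ?_
  have h1 := hC (n + 1) n
  have h2 : (1 : ℝ) ≤ a (n + 1) n := by exact_mod_cast a_star_pos (by omega)
  have h3 : (‖x‖ * ζ) ^ n ≤ C / ‖x‖ := by
    rw [le_div_iff₀ hx]
    calc (‖x‖ * ζ) ^ n * ‖x‖ = 1 * ‖x‖ ^ (n + 1) * ζ ^ n := by rw [mul_pow]; ring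
      _ ≤ (a (n + 1) n : ℝ) * ‖x‖ ^ (n + 1) * ζ ^ n := by gcongr
      _ ≤ C := h1
  refine h3.trans (le_mul_of_one_le_right (by positivity) ?_)
  have : (0 : ℝ) ≤ (n : ℝ) := Nat.cast_nonneg _
  linarith

theorem norm_mul_sqrt_le_one_of_mem {x : ℂ} {ζ : ℝ} (hζ : 0 < ζ)
    (h : (x, (ζ : ℂ)) ∈ convergenceDomain) : ‖x‖ * Real.sqrt ζ ≤ 1 := by
  have h1 := norm_le_one_of_mem hζ h
  have h2 := norm_mul_le_one_of_mem hζ h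
  have h3 := Real.sq_sqrt hζ.le
  have h4 := norm_nonneg x
  refine abs_le_one_iff_mul_self_le_one.2 ?_ |> (le_abs_self _).trans
  calc ‖x‖ * Real.sqrt ζ * (‖x‖ * Real.sqrt ζ) = ‖x‖ * (‖x‖ * Real.sqrt ζ ^ 2) := by ring
    _ ≤ 1 * 1 := by
      rw [h3]
      exact mul_le_mul h1 h2 (by positivity) zero_le_one
    _ = 1 := one_mul 1

theorem norm_mul_sqrt_le_x₀ {x : ℂ} {ζ : ℝ} (hζ : 0 < ζ)
    (h : (x, (ζ : ℂ)) ∈ convergenceDomain) : ‖x‖ * Real.sqrt ζ ≤ x₀ := by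
  have h1 : ‖x‖ ≤ r ζ := by
    refine le_csSup ⟨1, ?_⟩ ⟨x, h, rfl⟩
    rintro _ ⟨y, hy, rfl⟩
    exact norm_le_one_of_mem hζ hy
  have h2 : r ζ * Real.sqrt ζ ≤ x₀ := by
    refine le_csSup ⟨1, ?_⟩ ⟨ζ, hζ, rfl⟩
    rintro _ ⟨ξ, hξ, rfl⟩
    have hs := Real.sqrt_pos.2 hξ
    rw [← le_div_iff₀ hs]
    refine Real.sSup_le ?_ (by positivity)
    rintro _ ⟨y, hy, rfl⟩
    rw [le_div_iff₀ hs]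
    exact norm_mul_sqrt_le_one_of_mem hξ hy
  exact (mul_le_mul_of_nonneg_right h1 (Real.sqrt_nonneg ζ)).trans h2

theorem exists_mem_of_lt_x₀ {θ : ℝ} (hθ0 : 0 ≤ θ) (hθ : θ < x₀) :
    ∃ (x : ℂ) (ζ : ℝ), 0 < ζ ∧ (x, (ζ : ℂ)) ∈ convergenceDomain ∧ θ < ‖x‖ * Real.sqrt ζ := by
  obtain ⟨_, ⟨ζ, hζ, rfl⟩, h1⟩ := exists_lt_of_lt_csSup (s := {y : ℝ | ∃ ζ : ℝ, 0 < ζ ∧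
    y = r ζ * Real.sqrt ζ}) ⟨_, 1, one_pos, rfl⟩ hθ
  have hs := Real.sqrt_pos.2 hζ
  rw [← div_lt_iff₀ hs] at h1
  have hne : {ρ : ℝ | ∃ x : ℂ, (x, (ζ : ℂ)) ∈ convergenceDomain ∧ ρ = ‖x‖}.Nonempty := by
    by_contra hempty
    rw [Set.not_nonempty_iff_eq_empty] at hempty
    rw [r, hempty, Real.sSup_empty] at h1
    exact absurd h1 (not_lt.2 (by positivity))
  obtain ⟨_, ⟨x, hx, rfl⟩, h2⟩ := exists_lt_of_lt_csSup hne h1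
  exact ⟨x, ζ, hζ, hx, (div_lt_iff₀ hs).1 h2⟩

theorem x₀_pos : 0 < x₀ := by
  have h : (((1 / 8 : ℝ) : ℂ), ((1 : ℝ) : ℂ)) ∈ convergenceDomain := by
    refine mem_of_bound (ρ := 1 / 4) (C := 1) one_pos (fun n k => ?_) (by norm_num) (by norm_num)
    have h1 : (a n k : ℝ) ≤ 4 ^ n := by
      exact_mod_cast (a_le_card_trees n k).trans (card_trees_le n)
    rw [one_pow, mul_one, div_pow, one_pow, mul_one_div]
    exact div_le_one_of_le₀ h1 (by positivity)
  have h1 := norm_mul_sqrt_le_x₀ one_pos h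
  rw [Complex.norm_real, Real.sqrt_one] at h1
  norm_num at h1
  linarith

/-! ### The upper bound -/

theorem sum_pow_leaves_le {C ρ ζ : ℝ} (hC : ∀ n k, (a n k : ℝ) * ρ ^ n * ζ ^ k ≤ C) (n : ℕ) :
    ρ ^ n * ∑ u ∈ trees n, ζ ^ u.leaves ≤ C * (n + 1) := by
  have h1 : ∑ u ∈ trees n, ζ ^ u.leaves = ∑ k ∈ Finset.range (n + 1), (a n k : ℝ) * ζ ^ k := by
    rw [← Finset.sum_fiberwise_of_maps_to (t := Finset.range (n + 1)) (g := UTree.leaves)]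
    · refine Finset.sum_congr rfl fun k _ => ?_
      rw [a_eq_card, Finset.sum_congr rfl fun u hu => by rw [(Finset.mem_filter.1 hu).2],
        Finset.sum_const, nsmul_eq_mul]
    · intro u hu
      rw [Finset.mem_range, Nat.lt_succ_iff, ← mem_trees.1 hu]
      exact u.leaves_le_size
  rw [h1, Finset.mul_sum]
  calc ∑ k ∈ Finset.range (n + 1), ρ ^ n * ((a n k : ℝ) * ζ ^ k)
      ≤ ∑ k ∈ Finset.range (n + 1), C := Finset.sum_le_sum fun k _ => by
        have := hC n k
        linarith
    _ = C * (n + 1) := by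
        rw [Finset.sum_const, Finset.card_range, nsmul_eq_mul]
        push_cast
        ring

/-- Since at most half of the vertices are leaves on average, the convex function
`∑ ζ ^ (leaves - n / 2)` of `log ζ` does not increase up to `ζ = 1`. -/
theorem card_trees_mul_pow_le {n : ℕ} (hn : 2 ≤ n) {s : ℝ} (hs : 0 < s) (hs1 : s ≤ 1) :
    (trees n).card * s ^ n ≤ ∑ u ∈ trees n, (s ^ 2) ^ u.leaves := by
  have h1 : ∀ u ∈ trees n, s ^ n * (1 + (u.excess : ℝ) * Real.log s) ≤ (s ^ 2) ^ u.leaves := by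
    intro u hu
    have h2 : (s ^ 2) ^ u.leaves = s ^ n * Real.exp ((u.excess : ℝ) * Real.log s) := by
      rw [mul_comm (u.excess : ℝ), ← Real.rpow_def_of_pos hs, Real.rpow_intCast, ← pow_mul,
        ← zpow_natCast, ← zpow_natCast, ← zpow_add₀ hs.ne', UTree.excess, mem_trees.1 hu]
      congr 1
      push_cast
      ring
    rw [h2]
    have := Real.add_one_le_exp ((u.excess : ℝ) * Real.log s)
    gcongr
    linarith
  refine le_trans ?_ (Finset.sum_le_sum h1)
  rw [← Finset.mul_sum, Finset.sum_add_distrib, ← Finset.sum_mul, Finset.sum_const, nsmul_one,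
    mul_comm]
  have h3 : (∑ u ∈ trees n, (u.excess : ℝ)) ≤ 0 := by
    rw [← Int.cast_sum]
    exact_mod_cast sum_excess_nonpos hn
  have h4 := mul_nonneg_of_nonpos_of_nonpos h3 (Real.log_nonpos hs.le hs1)
  gcongr
  linarith

/-- The number of trees with at least half of their vertices as leaves, in terms of any point of the
domain of convergence. For `ζ ≤ 1` it is bounded by the number of all trees. -/
theorem exists_card_mul_pow_le {x : ℂ} {ζ : ℝ} (hζ : 0 < ζ)
    (h : (x, (ζ : ℂ)) ∈ convergenceDomain) :
    ∃ C : ℝ, 0 < C ∧ ∀ (n : ℕ) (κ : ℤ), 2 ≤ n → (n : ℤ) ≤ 2 * κ →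
      (((trees n).filter fun u => κ ≤ (u.leaves : ℤ)).card : ℝ) * (‖x‖ * Real.sqrt ζ) ^ n ≤
        C * (n + 1) := by
  obtain ⟨C, hC0, hC⟩ := exists_bound_of_mem hζ h
  refine ⟨C, hC0, fun n κ hn hκ => le_trans ?_ (sum_pow_leaves_le hC n)⟩
  set s := Real.sqrt ζ with hs
  have hs0 : 0 < s := Real.sqrt_pos.2 hζ
  have hs2 : s ^ 2 = ζ := Real.sq_sqrt hζ.le
  rw [mul_pow, mul_left_comm]
  refine mul_le_mul_of_nonneg_left ?_ (by positivity)
  rcases le_total s 1 with h1 | h1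
  · rw [← hs2]
    refine le_trans ?_ (card_trees_mul_pow_le hn hs0 h1)
    have := Finset.card_filter_le (trees n) fun u => κ ≤ (u.leaves : ℤ)
    gcongr
  · calc _ = ∑ u ∈ (trees n).filter fun u => κ ≤ (u.leaves : ℤ), s ^ n := by
          rw [Finset.sum_const, nsmul_eq_mul]
      _ ≤ ∑ u ∈ (trees n).filter fun u => κ ≤ (u.leaves : ℤ), ζ ^ u.leaves := by
          refine Finset.sum_le_sum fun u hu => ?_
          have h2 := (Finset.mem_filter.1 hu).2
          rw [← hs2, ← pow_mul]
          exact pow_le_pow_right₀ h1 (by omega)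
      _ ≤ ∑ u ∈ trees n, ζ ^ u.leaves :=
          Finset.sum_le_sum_of_subset_of_nonneg (Finset.filter_subset _ _)
            fun _ _ _ => by positivity

theorem le_half_of_card_trees_mul_pow_le {y C : ℝ} (hy : 0 ≤ y)
    (h : ∀ n : ℕ, 2 ≤ n → (trees n).card * y ^ n ≤ C * (n + 1)) : y ≤ 1 / 2 := by
  have : 2 * y ≤ 1 := by
    refine le_one_of_pow_le (C := 4 * C) fun n hn => ?_
    obtain ⟨m, rfl⟩ : ∃ m, n = m + 2 := ⟨n - 2, by omega⟩
    have h1 : (2 : ℝ) ^ m ≤ (trees (m + 2)).card := by exact_mod_cast two_pow_le_card_trees m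
    calc (2 * y) ^ (m + 2) = 4 * (2 ^ m * y ^ (m + 2)) := by rw [mul_pow, pow_add 2 m]; ring
      _ ≤ 4 * ((trees (m + 2)).card * y ^ (m + 2)) := by gcongr
      _ ≤ 4 * (C * ((m + 2 : ℕ) + 1)) := mul_le_mul_of_nonneg_left (h _ hn) (by norm_num)
      _ = _ := by ring
  linarith

theorem sq_le_half_of_mem {x : ℂ} {ζ : ℝ} (hζ : 0 < ζ) (h : (x, (ζ : ℂ)) ∈ convergenceDomain) :
    (‖x‖ * Real.sqrt ζ) ^ 2 ≤ 1 / 2 := by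
  obtain ⟨C, hC0, hC⟩ := exists_bound_of_mem hζ h
  set s := Real.sqrt ζ with hs
  have hs0 : 0 < s := Real.sqrt_pos.2 hζ
  have hs2 : s ^ 2 = ζ := Real.sq_sqrt hζ.le
  rcases le_total s 1 with h1 | h1
  · have hy : ‖x‖ * s ≤ 1 / 2 := by
      refine le_half_of_card_trees_mul_pow_le (C := C) (by positivity) fun n hn => ?_
      refine le_trans ?_ (sum_pow_leaves_le hC n)
      rw [mul_pow, mul_left_comm, ← hs2]
      exact mul_le_mul_of_nonneg_left (card_trees_mul_pow_le hn hs0 h1) (by positivity)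
    have : 0 ≤ ‖x‖ * s := by positivity
    nlinarith
  · have hy : ‖x‖ ≤ 1 / 2 := by
      refine le_half_of_card_trees_mul_pow_le (C := C) (norm_nonneg x) fun n hn => ?_
      refine le_trans ?_ (sum_pow_leaves_le hC n)
      rw [mul_comm]
      refine mul_le_mul_of_nonneg_left ?_ (by positivity)
      rw [Finset.card_eq_sum_ones, Nat.cast_sum]
      refine Finset.sum_le_sum fun u _ => ?_
      rw [Nat.cast_one, ← hs2]
      exact one_le_pow₀ (one_le_pow₀ h1)
    have h2 := norm_mul_le_one_of_mem hζ h
    rw [mul_pow, hs2, sq, mul_assoc]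
    calc ‖x‖ * (‖x‖ * ζ) ≤ 1 / 2 * 1 := mul_le_mul hy h2 (by positivity) (by norm_num)
      _ = 1 / 2 := mul_one _

theorem x₀_lt_one : x₀ < 1 := by
  by_contra! h
  obtain ⟨x, ζ, hζ, hx, h1⟩ := exists_mem_of_lt_x₀ (θ := 3 / 4) (by norm_num) (by linarith)
  have h2 := sq_le_half_of_mem hζ hx
  nlinarith

/-! ### The lower bound -/

/-- Points beyond `x₀` lie outside the domain of convergence, so the terms there are not bounded. -/
theorem exists_large_term {θ ζ : ℝ} (hθ : x₀ < θ) (hζ : 0 < ζ) (n₀ : ℕ) :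
    ∃ n, n₀ ≤ n ∧ ∃ k, 1 < (a n k : ℝ) * (θ / Real.sqrt ζ) ^ n * ζ ^ k := by
  by_contra! hcon
  obtain ⟨θ', h1, h2⟩ := exists_between hθ
  have hs : 0 < Real.sqrt ζ := Real.sqrt_pos.2 hζ
  have hθ'0 : 0 < θ' := x₀_pos.trans h1
  have hθ0 : 0 < θ := hθ'0.trans h2
  set f : ℕ → ℕ → ℝ := fun n k => (a n k : ℝ) * (θ / Real.sqrt ζ) ^ n * ζ ^ k with hf
  have hf0 : ∀ n k, 0 ≤ f n k := fun n k => by positivity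
  have hbound : ∀ n k, f n k ≤
      1 + ∑ i ∈ Finset.range n₀, ∑ j ∈ Finset.range n₀, f i j := by
    intro n k
    have hs0 : 0 ≤ ∑ i ∈ Finset.range n₀, ∑ j ∈ Finset.range n₀, f i j :=
      Finset.sum_nonneg fun i _ => Finset.sum_nonneg fun j _ => hf0 i j
    rcases le_or_gt n₀ n with hn | hn
    · have := hcon n hn k
      linarith
    · rcases lt_or_ge n k with hk | hk
      · have : f n k = 0 := by simp [hf, a_eq_zero_of_lt hk]
        linarith
      · have h3 : f n k ≤ ∑ j ∈ Finset.range n₀, f n j :=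
          Finset.single_le_sum (f := fun j => f n j) (fun j _ => hf0 n j)
            (Finset.mem_range.2 (hk.trans_lt hn))
        have h4 : ∑ j ∈ Finset.range n₀, f n j ≤
            ∑ i ∈ Finset.range n₀, ∑ j ∈ Finset.range n₀, f i j :=
          Finset.single_le_sum (f := fun i => ∑ j ∈ Finset.range n₀, f i j)
            (fun i _ => Finset.sum_nonneg fun j _ => hf0 i j) (Finset.mem_range.2 hn)
        linarith
  have hmem := mem_of_bound (ρ' := θ' / Real.sqrt ζ) hζ hbound (by positivity) (by gcongr)
  have h3 := norm_mul_sqrt_le_x₀ hζ hmem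
  rw [Complex.norm_real, Real.norm_of_nonneg (by positivity), div_mul_cancel₀ _ hs.ne'] at h3
  linarith

/-- The counts `a n k`, shifted so that they become supermultiplicative. -/
noncomputable def shiftedCount (n k : ℕ) : ℕ := a (n - 4) (k - 1)

theorem shiftedCount_mul_le {n₁ k₁ n₂ k₂ : ℕ} (hn₁ : 4 ≤ n₁) (hk₁ : 1 ≤ k₁) (hn₂ : 4 ≤ n₂)
    (hk₂ : 1 ≤ k₂) :
    shiftedCount n₁ k₁ * shiftedCount n₂ k₂ ≤ shiftedCount (n₁ + n₂) (k₁ + k₂) := by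
  have h := a_mul_a_le (n₁ - 4) (k₁ - 1) (n₂ - 4) (k₂ - 1)
  have h1 : n₁ - 4 + (n₂ - 4) + 4 = n₁ + n₂ - 4 := by omega
  have h2 : k₁ - 1 + (k₂ - 1) + 1 = k₁ + k₂ - 1 := by omega
  rwa [h1, h2] at h

theorem shiftedCount_pow_le {n k : ℕ} (hn : 4 ≤ n) (hk : 1 ≤ k) {i : ℕ} (hi : 0 < i) :
    shiftedCount n k ^ i ≤ shiftedCount (i * n) (i * k) := by
  induction i, hi using Nat.le_induction with
  | base => simp
  | succ i hi ih =>
    rw [pow_succ, add_mul, add_mul, one_mul, one_mul]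
    refine (Nat.mul_le_mul_right _ ih).trans (shiftedCount_mul_le ?_ ?_ hn hk)
    · nlinarith
    · nlinarith

/-- For every weight, some class of trees is large. Here `exp (2 σ)` is the second coordinate `ζ`, and
the passage from a rate `ν > μ` to `μ` absorbs the shift of the counts. -/
theorem exists_shiftedCount_ge {μ σ : ℝ} (hμ0 : 0 < μ) (hμ : μ < 1 / x₀) :
    ∃ n k : ℕ, 5 ≤ n ∧ 1 ≤ k ∧
      μ ^ n ≤ shiftedCount n k * Real.exp (σ * (2 * (k : ℝ) - n)) := by
  obtain ⟨ν, h1, h2⟩ := exists_between hμ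
  have hν0 : 0 < ν := hμ0.trans h1
  have hratio : 1 < ν / μ := (one_lt_div hμ0).2 h1
  obtain ⟨n₀, hn₀⟩ := eventually_atTop.1
    ((tendsto_pow_atTop_atTop_of_one_lt hratio).eventually_ge_atTop (μ ^ 4 * Real.exp (2 * σ)))
  have hθ : x₀ < 1 / ν := by rwa [lt_one_div x₀_pos hν0]
  obtain ⟨m, hm, j, hj⟩ := exists_large_term hθ (Real.exp_pos (2 * σ)) (n₀ + 1)
  have hsqrt : Real.sqrt (Real.exp (2 * σ)) = Real.exp σ := by
    rw [Real.sqrt_eq_iff_mul_self_eq_of_pos (Real.exp_pos _), ← Real.exp_add]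
    congr 1; ring
  refine ⟨m + 4, j + 1, by omega, by omega, ?_⟩
  have h3 := hn₀ m (by omega)
  rw [div_pow, le_div_iff₀ (by positivity)] at h3
  have h4 : ν ^ m ≤ (a m j : ℝ) * Real.exp (σ * (2 * (j : ℝ) - m)) := by
    have h5 : (a m j : ℝ) * (1 / ν / Real.sqrt (Real.exp (2 * σ))) ^ m * Real.exp (2 * σ) ^ j =
        (a m j : ℝ) * Real.exp (σ * (2 * (j : ℝ) - m)) / ν ^ m := by
      rw [hsqrt, div_div, one_div, inv_pow, mul_pow, ← Real.exp_nat_mul, ← Real.exp_nat_mul,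
        mul_inv, ← Real.exp_neg, div_eq_mul_inv, mul_assoc, mul_assoc, mul_assoc, ← Real.exp_add]
      have : -((m : ℝ) * σ) + j * (2 * σ) = σ * (2 * (j : ℝ) - m) := by ring
      rw [this]
      ring
    rw [h5, lt_div_iff₀ (by positivity), one_mul] at hj
    exact hj.le
  have h6 : shiftedCount (m + 4) (j + 1) = a m j := rfl
  have h7 : σ * (2 * ((j + 1 : ℕ) : ℝ) - ((m + 4 : ℕ) : ℝ)) = σ * (2 * (j : ℝ) - m) + -(2 * σ) := by
    push_cast; ring
  rw [h6, h7, Real.exp_add, Real.exp_neg, ← mul_assoc, ← div_eq_mul_inv,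
    le_div_iff₀ (Real.exp_pos _)]
  calc μ ^ (m + 4) * Real.exp (2 * σ) = μ ^ 4 * Real.exp (2 * σ) * μ ^ m := by
        rw [pow_add]; ring
    _ ≤ ν ^ m := h3
    _ ≤ _ := h4

/-- Some class of trees has at least half of its vertices as leaves and is large compared with the
size. Among the classes that `exists_shiftedCount_ge` provides for the weights `σ = 0, δ, 2δ, …`,
consider the first with many leaves; there is one, as stars show. If it does not occur at `σ = 0`,
suitable multiples of it and of its predecessor, which has few leaves, combine to a class in which
the weights cancel. -/
theorem exists_block {μ : ℝ} (hμ0 : 0 < μ) (hμ : μ < 1 / x₀) :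
    ∃ n k : ℕ, 5 ≤ n ∧ 1 ≤ k ∧ n ≤ 2 * k ∧ μ ^ n ≤ shiftedCount n k := by
  obtain ⟨ν, h1, h2⟩ := exists_between hμ
  have hν0 : 0 < ν := hμ0.trans h1
  set δ := Real.log (ν / μ) with hδ
  have hδ0 : 0 < δ := Real.log_pos ((one_lt_div hμ0).2 h1)
  let P : ℕ → Prop := fun i => ∃ n k : ℕ, 5 ≤ n ∧ 1 ≤ k ∧ n ≤ 2 * k ∧
    ν ^ n ≤ shiftedCount n k * Real.exp ((i * δ) * (2 * (k : ℝ) - n))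
  have hex : ∃ i, P i := by
    obtain ⟨i, hi⟩ := exists_nat_ge (5 * Real.log ν / δ)
    rw [div_le_iff₀ hδ0] at hi
    -- The star with five leaves gains from a large weight.
    refine ⟨i, 10, 6, by norm_num, by norm_num, by norm_num, ?_⟩
    have h3 : (1 : ℝ) ≤ shiftedCount 10 6 := by
      exact_mod_cast a_star_pos (n := 5) (by norm_num)
    calc ν ^ 10 = Real.exp (((10 : ℕ) : ℝ) * Real.log ν) := by
          rw [Real.exp_nat_mul, Real.exp_log hν0]
      _ ≤ Real.exp ((i * δ) * (2 * ((6 : ℕ) : ℝ) - (10 : ℕ))) := by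
          rw [Real.exp_le_exp]; push_cast; linarith
      _ ≤ _ := le_mul_of_one_le_left (Real.exp_pos _).le h3
  classical
  obtain ⟨n₁, k₁, hn₁, hk₁, hnk₁, h3⟩ := Nat.find_spec hex
  rcases Nat.eq_zero_or_pos (Nat.find hex) with h0 | hpos
  · refine ⟨n₁, k₁, hn₁, hk₁, hnk₁, ?_⟩
    rw [h0, Nat.cast_zero, zero_mul, zero_mul, Real.exp_zero, mul_one] at h3
    exact (pow_le_pow_left₀ hμ0.le h1.le _).trans h3
  obtain ⟨i, hi⟩ : ∃ i, Nat.find hex = i + 1 := ⟨Nat.find hex - 1, by omega⟩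
  have hnot : ¬ P i := Nat.find_min hex (by omega)
  set σ := (i : ℝ) * δ with hσ
  obtain ⟨n₂, k₂, hn₂, hk₂, h4⟩ := exists_shiftedCount_ge (σ := σ) hν0 h2
  have hnk₂ : 2 * k₂ < n₂ := by
    by_contra! h
    exact hnot ⟨n₂, k₂, hn₂, hk₂, h, h4⟩
  have h5 : μ ^ n₁ ≤ shiftedCount n₁ k₁ * Real.exp (σ * (2 * (k₁ : ℝ) - n₁)) := by
    have hk : k₁ ≤ n₁ := by
      by_contra! hlt
      have : shiftedCount n₁ k₁ = 0 := a_eq_zero_of_lt (by omega)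
      rw [this, Nat.cast_zero, zero_mul] at h3
      exact absurd h3 (not_le.2 (by positivity))
    have hk' : (k₁ : ℝ) ≤ n₁ := by exact_mod_cast hk
    have h6 : Real.exp (((Nat.find hex : ℕ) : ℝ) * δ * (2 * (k₁ : ℝ) - n₁)) ≤
        Real.exp (σ * (2 * (k₁ : ℝ) - n₁)) * (ν / μ) ^ n₁ := by
      have h7 : (ν / μ) ^ n₁ = Real.exp (n₁ * δ) := by
        rw [Real.exp_nat_mul, Real.exp_log (by positivity)]
      rw [h7, ← Real.exp_add, Real.exp_le_exp, hi, hσ]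
      push_cast
      nlinarith
    have h8 := h3.trans (mul_le_mul_of_nonneg_left h6 (Nat.cast_nonneg _))
    rw [div_pow, ← mul_assoc, mul_div_assoc', le_div_iff₀ (by positivity), mul_comm (ν ^ n₁)] at h8
    exact le_of_mul_le_mul_right h8 (by positivity)
  have h6 : μ ^ n₂ ≤ shiftedCount n₂ k₂ * Real.exp (σ * (2 * (k₂ : ℝ) - n₂)) :=
    (pow_le_pow_left₀ hμ0.le h1.le _).trans h4
  rcases Nat.eq_or_lt_of_le hnk₁ with heq | hlt
  · refine ⟨n₁, k₁, hn₁, hk₁, hnk₁, ?_⟩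
    have : (n₁ : ℝ) = 2 * k₁ := by exact_mod_cast heq
    rwa [this, sub_self, mul_zero, Real.exp_zero, mul_one] at h5
  obtain ⟨p, hp⟩ : ∃ p, n₂ = 2 * k₂ + p := ⟨n₂ - 2 * k₂, by omega⟩
  obtain ⟨q, hq⟩ : ∃ q, 2 * k₁ = n₁ + q := ⟨2 * k₁ - n₁, by omega⟩
  have hp0 : 0 < p := by omega
  have hq0 : 0 < q := by omega
  have hpn : n₁ ≤ p * n₁ := Nat.le_mul_of_pos_left _ hp0
  have hqn : n₂ ≤ q * n₂ := Nat.le_mul_of_pos_left _ hq0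
  have hpk : k₁ ≤ p * k₁ := Nat.le_mul_of_pos_left _ hp0
  have hqk : k₂ ≤ q * k₂ := Nat.le_mul_of_pos_left _ hq0
  refine ⟨p * n₁ + q * n₂, p * k₁ + q * k₂, by omega, by omega, ?_, ?_⟩
  · have : 2 * (p * k₁ + q * k₂) = p * (2 * k₁) + q * (2 * k₂) := by ring
    rw [this, hq, hp]
    nlinarith
  · have h9 : shiftedCount n₁ k₁ ^ p * shiftedCount n₂ k₂ ^ q ≤
        shiftedCount (p * n₁ + q * n₂) (p * k₁ + q * k₂) :=
      (Nat.mul_le_mul (shiftedCount_pow_le (by omega) hk₁ hp0)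
        (shiftedCount_pow_le (by omega) hk₂ hq0)).trans
        (shiftedCount_mul_le (by omega) (by omega) (by omega) (by omega))
    have e1 : 2 * (k₁ : ℝ) - n₁ = q := by
      have : 2 * (k₁ : ℝ) = n₁ + q := by exact_mod_cast hq
      rw [this]; ring
    have e2 : 2 * (k₂ : ℝ) - n₂ = -p := by
      have : (n₂ : ℝ) = 2 * k₂ + p := by exact_mod_cast hp
      rw [this]; ring
    rw [e1] at h5
    rw [e2] at h6
    calc μ ^ (p * n₁ + q * n₂) = (μ ^ n₁) ^ p * (μ ^ n₂) ^ q := by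
          rw [pow_add, ← pow_mul, ← pow_mul, mul_comm n₁, mul_comm n₂]
      _ ≤ (shiftedCount n₁ k₁ * Real.exp (σ * q)) ^ p *
          (shiftedCount n₂ k₂ * Real.exp (σ * -p)) ^ q := by gcongr
      _ = (shiftedCount n₁ k₁ : ℝ) ^ p * (shiftedCount n₂ k₂ : ℝ) ^ q := by
          rw [mul_pow, mul_pow, ← Real.exp_nat_mul, ← Real.exp_nat_mul, mul_mul_mul_comm,
            ← Real.exp_add]
          have : (p : ℝ) * (σ * q) + q * (σ * -p) = 0 := by ring
          rw [this, Real.exp_zero, mul_one]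
      _ ≤ _ := by exact_mod_cast h9

/-- Many copies of a class from `exists_block`, and leaves at the root that fill up the size. -/
theorem pow_le_card_filter {μ : ℝ} (hμ0 : 1 ≤ μ) (hμ : μ < 1 / x₀) :
    ∃ n : ℕ, 0 < n ∧ ∀ (V e : ℕ) (κ : ℤ), 2 * n ≤ e → e ≤ V → 2 * ((V : ℤ) - κ) = e →
      μ ^ (e - n) ≤ (((trees V).filter fun u => κ ≤ (u.leaves : ℤ)).card : ℝ) := by
  obtain ⟨n, k, hn, hk, hnk, hb⟩ := exists_block (by linarith) hμ
  refine ⟨n, by omega, fun V e κ h1 h2 h3 => ?_⟩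
  have hq : 2 ≤ e / n := (Nat.le_div_iff_mul_le (by omega)).2 h1
  set q := e / n with hqdef
  have h4 : q * n ≤ e := Nat.div_mul_le_self e n
  have h5 : e < (q + 1) * n := by
    rw [hqdef, mul_comm]
    exact Nat.lt_mul_div_succ e (by omega)
  have h6 : 10 ≤ q * n := by nlinarith
  have h7 : q * n ≤ 2 * (q * k) := by nlinarith
  have h8 : 1 ≤ q * k := by nlinarith
  have h9 : shiftedCount (q * n) (q * k) ≤
      ((trees V).filter fun u => κ ≤ (u.leaves : ℤ)).card := by
    refine a_le_card_filter (j := V - (q * n - 4)) (by omega) (by omega) ?_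
    generalize q * n = A at *
    generalize q * k = B at *
    omega
  calc μ ^ (e - n) ≤ μ ^ (q * n) := by
        refine pow_le_pow_right₀ hμ0 ?_
        rw [add_mul, one_mul] at h5
        omega
    _ = (μ ^ n) ^ q := by rw [mul_comm, pow_mul]
    _ ≤ (shiftedCount n k : ℝ) ^ q := by gcongr
    _ ≤ (shiftedCount (q * n) (q * k) : ℝ) := by
        exact_mod_cast shiftedCount_pow_le (by omega) hk (by omega)
    _ ≤ _ := by exact_mod_cast h9

/-! ### The asymptotics of `L d` -/

/-- Twice the number `N d - K d` of vertices that need not be leaves. -/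
def twiceNonleaves (d : ℕ) : ℕ := 2 * ((d - 1) / 2 * ((d - 1) / 2 - 1)) + 2

theorem two_mul_N_sub_K (d : ℕ) : 2 * ((N d : ℤ) - K d) = twiceNonleaves d := by
  rw [K, twiceNonleaves]
  generalize (d - 1) / 2 = m
  rcases m with _ | m
  · simp
  · push_cast [Nat.add_sub_cancel]
    ring

theorem N_bounds (d : ℕ) (hd : 3 ≤ d) :
    twiceNonleaves d ≤ N d ∧ |2 * (N d : ℝ) - d ^ 2| ≤ 20 * (d : ℝ) ∧
      |2 * (twiceNonleaves d : ℝ) - d ^ 2| ≤ 20 * (d : ℝ) := by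
  have habs : ∀ x y : ℝ, -y ≤ x → x ≤ y → |x| ≤ y := fun x y h1 h2 => abs_le.2 ⟨h1, h2⟩
  rcases Nat.even_or_odd' d with ⟨m, rfl | rfl⟩
  · obtain ⟨m, rfl⟩ : ∃ i, m = i + 2 := ⟨m - 2, by omega⟩
    have h1 : (2 * (m + 2) - 1) / 2 = m + 1 := by omega
    have h2 : N (2 * (m + 2)) = (2 * m + 3) * (m + 1) + 2 := by
      rw [N, if_neg (by simp)]
      have e1 : 2 * (m + 2) - 1 = 2 * m + 3 := by omega
      have e2 : 2 * (m + 2) - 2 = 2 * (m + 1) := by omega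
      rw [e1, e2, mul_left_comm, Nat.mul_div_cancel_left _ two_pos]
    have h3 : twiceNonleaves (2 * (m + 2)) = 2 * ((m + 1) * m) + 2 := by
      rw [twiceNonleaves, h1, Nat.add_sub_cancel]
    have hm : (0 : ℝ) ≤ m := Nat.cast_nonneg m
    rw [h2, h3]
    refine ⟨by nlinarith, ?_, ?_⟩ <;> push_cast <;> apply habs <;> nlinarith
  · obtain ⟨m, rfl⟩ : ∃ i, m = i + 1 := ⟨m - 1, by omega⟩
    have h1 : (2 * (m + 1) + 1 - 1) / 2 = m + 1 := by omega
    have h2 : N (2 * (m + 1) + 1) = (m + 1) * (2 * m + 1) + 1 := by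
      rw [N, if_pos (by simp)]
      have e1 : 2 * (m + 1) + 1 - 1 = 2 * (m + 1) := by omega
      have e2 : 2 * (m + 1) + 1 - 2 = 2 * m + 1 := by omega
      rw [e1, e2, mul_assoc, Nat.mul_div_cancel_left _ two_pos]
    have h3 : twiceNonleaves (2 * (m + 1) + 1) = 2 * ((m + 1) * m) + 2 := by
      rw [twiceNonleaves, h1, Nat.add_sub_cancel]
    have hm : (0 : ℝ) ≤ m := Nat.cast_nonneg m
    rw [h2, h3]
    refine ⟨by nlinarith, ?_, ?_⟩ <;> push_cast <;> apply habs <;> nlinarith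

theorem tendsto_div_sq {f : ℕ → ℝ} (hf : ∀ᶠ d : ℕ in atTop, |2 * f d - d ^ 2| ≤ 20 * (d : ℝ)) :
    Tendsto (fun d : ℕ => f d / ((d : ℝ) ^ 2 / 2)) atTop (nhds 1) := by
  rw [tendsto_iff_norm_sub_tendsto_zero]
  have h0 : Tendsto (fun d : ℕ => 20 / (d : ℝ)) atTop (nhds 0) :=
    tendsto_const_div_atTop_nhds_zero_nat 20
  refine squeeze_zero' (Eventually.of_forall fun _ => norm_nonneg _) ?_ h0
  filter_upwards [hf, eventually_gt_atTop 0] with d hd hpos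
  have hd0 : (0 : ℝ) < d := by exact_mod_cast hpos
  have : f d / ((d : ℝ) ^ 2 / 2) - 1 = (2 * f d - d ^ 2) / (d : ℝ) ^ 2 := by
    field_simp
  rw [this, Real.norm_eq_abs, abs_div, abs_of_pos (by positivity : (0 : ℝ) < (d : ℝ) ^ 2),
    div_le_div_iff₀ (by positivity) hd0]
  nlinarith

theorem tendsto_N_div : Tendsto (fun d : ℕ => (N d : ℝ) / ((d : ℝ) ^ 2 / 2)) atTop (nhds 1) :=
  tendsto_div_sq (eventually_atTop.2 ⟨3, fun d hd => (N_bounds d hd).2.1⟩)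

theorem tendsto_twiceNonleaves_div :
    Tendsto (fun d : ℕ => (twiceNonleaves d : ℝ) / ((d : ℝ) ^ 2 / 2)) atTop (nhds 1) :=
  tendsto_div_sq (eventually_atTop.2 ⟨3, fun d hd => (N_bounds d hd).2.2⟩)

theorem tendsto_sq_half : Tendsto (fun d : ℕ => (d : ℝ) ^ 2 / 2) atTop atTop :=
  ((tendsto_pow_atTop two_ne_zero).comp tendsto_natCast_atTop_atTop).atTop_div_const two_pos

theorem tendsto_const_div_sq (c : ℝ) :
    Tendsto (fun d : ℕ => c / ((d : ℝ) ^ 2 / 2)) atTop (nhds 0) :=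
  Tendsto.div_atTop tendsto_const_nhds tendsto_sq_half

theorem tendsto_N : Tendsto (fun d : ℕ => (N d : ℝ)) atTop atTop := by
  have h := tendsto_sq_half.atTop_mul_pos one_pos tendsto_N_div
  refine h.congr' ?_
  filter_upwards [eventually_gt_atTop 0] with d hd
  have hd0 : (0 : ℝ) < d := by exact_mod_cast hd
  field_simp

theorem tendsto_log_N_div :
    Tendsto (fun d : ℕ => Real.log ((N d : ℝ) + 1) / ((d : ℝ) ^ 2 / 2)) atTop (nhds 0) := by
  have h1 : Tendsto (fun x : ℝ => Real.log x / x) atTop (nhds 0) :=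
    Real.isLittleO_log_id_atTop.tendsto_div_nhds_zero
  have h2 : Tendsto (fun d : ℕ => (N d : ℝ) + 1) atTop atTop :=
    tendsto_N.atTop_add tendsto_const_nhds
  have h3 : Tendsto (fun d : ℕ => ((N d : ℝ) + 1) / ((d : ℝ) ^ 2 / 2)) atTop (nhds (1 + 0)) := by
    simpa only [add_div] using tendsto_N_div.add (tendsto_const_div_sq 1)
  have h4 := (h1.comp h2).mul h3
  rw [zero_mul] at h4
  refine h4.congr fun d => ?_
  have : (N d : ℝ) + 1 ≠ 0 := by positivity
  simp only [Function.comp_apply]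
  rw [div_mul_div_cancel₀ this]

theorem C₁_pos : 0 < C₁ := one_div_pos.2 x₀_pos

theorem one_lt_C₁ : 1 < C₁ := (one_lt_div x₀_pos).2 x₀_lt_one

theorem eventually_le_log_L {c : ℝ} (hc0 : 0 ≤ c) (hc : c < Real.log C₁) :
    ∃ n : ℕ, ∀ᶠ d : ℕ in atTop, 0 < L d ∧ c * ((twiceNonleaves d : ℝ) - n) ≤ Real.log (L d) := by
  have hμ : Real.exp c < 1 / x₀ := (Real.lt_log_iff_exp_lt C₁_pos).1 hc
  obtain ⟨n, hn0, hn⟩ := pow_le_card_filter (Real.one_le_exp hc0) hμ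
  have hcov : Tendsto (fun d : ℕ => (twiceNonleaves d : ℝ)) atTop atTop := by
    refine (tendsto_sq_half.atTop_mul_pos one_pos tendsto_twiceNonleaves_div).congr' ?_
    filter_upwards [eventually_gt_atTop 0] with d hd
    have hd0 : (0 : ℝ) < d := by exact_mod_cast hd
    field_simp
  refine ⟨n, ?_⟩
  filter_upwards [eventually_ge_atTop 3, hcov.eventually_ge_atTop ((2 * n : ℕ) : ℝ)] with d hd hd2
  have hd3 : 2 * n ≤ twiceNonleaves d := by exact_mod_cast hd2
  have h1 := hn (N d) (twiceNonleaves d) (K d) hd3 (N_bounds d hd).1 (two_mul_N_sub_K d)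
  rw [← L_eq_card] at h1
  have h2 : (0 : ℝ) < L d := lt_of_lt_of_le (by positivity) h1
  refine ⟨by exact_mod_cast h2, ?_⟩
  rw [Real.le_log_iff_exp_le h2]
  refine le_trans (le_of_eq ?_) h1
  rw [← Real.exp_nat_mul, Nat.cast_sub (by omega), mul_comm]

theorem eventually_log_L_le {c : ℝ} (hc : Real.log C₁ < c) :
    ∃ C : ℝ, ∀ᶠ d : ℕ in atTop, 0 < L d →
      Real.log (L d) ≤ C + Real.log ((N d : ℝ) + 1) + c * N d := by
  have hθ : Real.exp (-c) < x₀ := by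
    rw [← Real.lt_log_iff_exp_lt x₀_pos]
    rw [C₁, one_div, Real.log_inv] at hc
    linarith
  obtain ⟨x, ζ, hζ, hx, hlt⟩ := exists_mem_of_lt_x₀ (Real.exp_pos _).le hθ
  obtain ⟨C, hC0, hC⟩ := exists_card_mul_pow_le hζ hx
  refine ⟨Real.log C, ?_⟩
  filter_upwards [eventually_ge_atTop 3] with d hd hL
  have h1 := (N_bounds d hd).1
  have h2 := two_mul_N_sub_K d
  have h3 : 2 ≤ twiceNonleaves d := Nat.le_add_left _ _
  have h4 := hC (N d) (K d) (by omega) (by omega)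
  rw [← L_eq_card] at h4
  have hL' : (0 : ℝ) < L d := by exact_mod_cast hL
  have h5 : (L d : ℝ) * Real.exp (-c) ^ N d ≤ C * ((N d : ℝ) + 1) := by
    refine le_trans ?_ h4
    gcongr
  have h6 := Real.log_le_log (by positivity) h5
  rw [Real.log_mul hL'.ne' (by positivity), Real.log_mul hC0.ne' (by positivity), Real.log_pow,
    Real.log_exp] at h6
  linarith

theorem tendsto_log_L_div :
    Tendsto (fun d : ℕ => Real.log (L d) / ((d : ℝ) ^ 2 / 2)) atTop (nhds (Real.log C₁)) := by
  have hlog : 0 < Real.log C₁ := Real.log_pos one_lt_C₁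
  rw [tendsto_order]
  constructor
  · intro b hb
    obtain ⟨c, hc1, hc2⟩ := exists_between (max_lt hb hlog)
    obtain ⟨n, hn⟩ := eventually_le_log_L ((le_max_right b 0).trans hc1.le) hc2
    have h1 : Tendsto (fun d : ℕ => c * ((twiceNonleaves d : ℝ) / ((d : ℝ) ^ 2 / 2) -
        n / ((d : ℝ) ^ 2 / 2))) atTop (nhds (c * (1 - 0))) :=
      (tendsto_twiceNonleaves_div.sub (tendsto_const_div_sq n)).const_mul c
    have h2 : b < c * (1 - 0) := by
      rw [sub_zero, mul_one]
      exact (le_max_left b 0).trans_lt hc1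
    filter_upwards [hn, h1.eventually_const_lt h2] with d hd1 hd2
    refine hd2.trans_le ?_
    rw [← sub_div, mul_div_assoc']
    gcongr
    exact hd1.2
  · intro b hb
    obtain ⟨c, hc1, hc2⟩ := exists_between hb
    obtain ⟨n, hn⟩ := eventually_le_log_L le_rfl hlog
    obtain ⟨C, hC⟩ := eventually_log_L_le hc1
    have h1 : Tendsto (fun d : ℕ => C / ((d : ℝ) ^ 2 / 2) +
        Real.log ((N d : ℝ) + 1) / ((d : ℝ) ^ 2 / 2) + c * ((N d : ℝ) / ((d : ℝ) ^ 2 / 2)))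
        atTop (nhds (0 + 0 + c * 1)) :=
      ((tendsto_const_div_sq C).add tendsto_log_N_div).add (tendsto_N_div.const_mul c)
    have h2 : 0 + 0 + c * 1 < b := by linarith
    filter_upwards [hn, hC, h1.eventually_lt_const h2] with d hd1 hd2 hd3
    refine lt_of_le_of_lt ?_ hd3
    rw [mul_div_assoc', ← add_div, ← add_div]
    gcongr
    exact hd2 hd1.1

end TreeLeaves

theorem proposition8 :
    TreeLeaves.ExpEquivalent (fun d : ℕ => (TreeLeaves.L d : ℝ))
      (fun d : ℕ => TreeLeaves.C₁ ^ ((d : ℝ) ^ 2 / 2)) := by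
  have hlog : Real.log TreeLeaves.C₁ ≠ 0 := (Real.log_pos TreeLeaves.one_lt_C₁).ne'
  have hv : ∀ d : ℕ, Real.log (TreeLeaves.C₁ ^ ((d : ℝ) ^ 2 / 2)) =
      (d : ℝ) ^ 2 / 2 * Real.log TreeLeaves.C₁ := fun d => Real.log_rpow TreeLeaves.C₁_pos _
  unfold TreeLeaves.ExpEquivalent
  simp only [hv]
  rw [isEquivalent_iff_tendsto_one]
  · have h := TreeLeaves.tendsto_log_L_div.div_const (Real.log TreeLeaves.C₁)
    rw [div_self hlog] at h
    refine h.congr fun d => ?_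
    rw [Pi.div_apply, div_div]
  · filter_upwards [eventually_gt_atTop 0] with d hd
    have hd0 : (0 : ℝ) < d := by exact_mod_cast hd
    positivity
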